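/- Let $K$ be a number field with algebraic closure $\overline K$, let $b\in K$, $b\neq 0$, and let $\mathcal E_1: y^2=x^3+bx$. Let $K_7=K(\mathcal E_1[7])$ be the field obtained from $K$ by adjoining the coordinates of all $7$-torsion points of $\mathcal E_1(\overline K)$. Let $i\in\overline K$ be a root of $x^2+1$, let $\zeta_7\in\overline K$ be a primitive $7$-th root of unity, and put $$\omega_1=(6i+4)\zeta_7^5+(6i-2)\zeta_7^4+(2i-2)\zeta_7^3+(2i+4)\zeta_7^2+8i\zeta_7+4i-3,$$ $$\theta_1=\tfrac17\big((-3520i-1568)\zeta_7^5+(-4800i+2352)\zeta_7^4+(-256i+2352)\zeta_7^3+(-1536i-1568)\zeta_7^2-5056i\zeta_7-2528i+3584\big).$$ For an arbitrary choice of the square roots in $\overline K$ let $\sqrt{\theta_1}$ be a square root of $\theta_1$, let $x_1=\sqrt{\omega_1b+\tfrac12b\sqrt{\theta_1}}$ and $y_1=\sqrt{(\omega_1+\tfrac12\sqrt{\theta_1}+1)\,b\,x_1}$. Consider the conditions - **A.** $i\notin K$; - **B1.** $\zeta_7+\zeta_7^{-1}\notin K(i)$; - **B2.** $\zeta_7\notin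 K(i,\zeta_7+\zeta_7^{-1})$; - **C.** $\sqrt{\theta_1}\notin K(i,\zeta_7)$; - **D.** $x_1\notin K(i,\zeta_7,\sqrt{\theta_1})$; - **E.** $y_1\notin K(i,\zeta_7,x_1)$. Then the possible degrees $[K_7:K]$ are exactly $96, 48, 32, 24, 16, 12, 8, 6, 4, 3, 2, 1$: the degree always is one of these numbers, and each of them is the degree $[K_7:K]$ for some number field $K$ and some nonzero $b\in K$. Moreover, for every $K$ and $b$ and every $d$, one has $[K_7:K]=d$ if and only if the set of those conditions among A, B1, B2, C, D, E that hold (all the others failing) is one of the sets listed for $d$ in the following table, where "$k$ among" means exactly $k$: - $d=96$: A, B1, B2, C, D, E; - $d=48$: B1, E and three among A, B2, C, D; - $d=32$: A, B2, C, D, E; - $d=24$: B1, E, C, D; or B1, E, one of A and B2, and one of C and D; - $d=16$: E and three among A, B2, C, D; - $d=12$: B1, E and one among A, B2, C, D; - $d=8$: E and two among A, B2, C, D; - $d=6$: B1 and one among A, B2, E; - $d=4$: A, B2; or E and one among A, B2, C, D; - $d=3$: B1; - $d=2$: one among A, B2, E; - $d=1$: no condition holds. (It is not claimed that every set in the table occurs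 for some $K$ and $b$.) -/

import Mathlib

namespace DivisionFieldSeven

/-- The curve `y² = x³ + b x`. -/
def curve {K : Type*} [Field K] (b : K) : WeierstrassCurve K :=
  ⟨0, 0, 0, b, 0⟩

open scoped Classical in
/-- The `m`-th division field `K(E[m])` inside an extension `L` of `K` (in the theorem `L` is an
algebraic closure of `K`): `K` with the coordinates of all affine points of `E(L)` killed by `m`
adjoined. -/
noncomputable def divisionField {K : Type*} [Field K] (W : WeierstrassCurve K)
    (L : Type*) [Field L] [Algebra K L] (m : ℕ) : IntermediateField K L :=
  IntermediateField.adjoin K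
    {z : L | ∃ (x y : L) (h : (W.baseChange L).toAffine.Nonsingular x y),
      m • (WeierstrassCurve.Affine.Point.some x y h : (W.baseChange L).toAffine.Point) = 0 ∧
        (z = x ∨ z = y)}

/-- The number `ω₁`, for a square root `i` of `-1` and a primitive seventh root of unity `ζ`. -/
def omegaOne {L : Type*} [Field L] (i ζ : L) : L :=
  (6 * i + 4) * ζ ^ 5 + (6 * i - 2) * ζ ^ 4 + (2 * i - 2) * ζ ^ 3 + (2 * i + 4) * ζ ^ 2
    + 8 * i * ζ + 4 * i - 3

/-- The number `θ₁`, for a square root `i` of `-1` and a primitive seventh root of unity `ζ`. -/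
def thetaOne {L : Type*} [Field L] (i ζ : L) : L :=
  1 / 7 * ((-3520 * i - 1568) * ζ ^ 5 + (-4800 * i + 2352) * ζ ^ 4 + (-256 * i + 2352) * ζ ^ 3
    + (-1536 * i - 1568) * ζ ^ 2 - 5056 * i * ζ - 2528 * i + 3584)

/-- The names of the six conditions. -/
inductive Cond
  | A | B1 | B2 | C | D | E
  deriving DecidableEq

instance : Fintype Cond :=
  ⟨{Cond.A, Cond.B1, Cond.B2, Cond.C, Cond.D, Cond.E}, fun c => by cases c <;> decide⟩

/-- The six conditions on `K`. Here `s` is a square root of `θ₁`, `x₁` a square root of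
`ω₁ b + b s / 2`, and `y₁` a square root of `(ω₁ + s / 2 + 1) b x₁`. -/
def Cond.Holds (K : Type*) [Field K] {L : Type*} [Field L] [Algebra K L] (i ζ s x₁ y₁ : L) :
    Cond → Prop
  | .A => i ∉ (⊥ : IntermediateField K L)
  | .B1 => ζ + ζ⁻¹ ∉ IntermediateField.adjoin K {i}
  | .B2 => ζ ∉ IntermediateField.adjoin K {i, ζ + ζ⁻¹}
  | .C => s ∉ IntermediateField.adjoin K {i, ζ}
  | .D => x₁ ∉ IntermediateField.adjoin K {i, ζ, s}
  | .E => y₁ ∉ IntermediateField.adjoin K {i, ζ, x₁}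

open scoped Classical in
/-- The set of those among the six conditions that hold. -/
noncomputable def holding (K : Type*) [Field K] {L : Type*} [Field L] [Algebra K L]
    (i ζ s x₁ y₁ : L) : Finset Cond :=
  Finset.univ.filter fun c => c.Holds K i ζ s x₁ y₁

open Cond in
/-- The table: `Table d T` says that `T` is one of the sets of conditions listed for the
degree `d`. -/
inductive Table : ℕ → Finset Cond → Prop
  | deg96 : Table 96 {A, B1, B2, C, D, E}
  | deg48 (S : Finset Cond) (hS : S ⊆ {A, B2, C, D}) (h : S.card = 3) : Table 48 ({B1, E} ∪ S)
  | deg32 : Table 32 {A, B2, C, D, E}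
  | deg24 : Table 24 {B1, E, C, D}
  | deg24' (p q : Cond) (hp : p = A ∨ p = B2) (hq : q = C ∨ q = D) : Table 24 {B1, E, p, q}
  | deg16 (S : Finset Cond) (hS : S ⊆ {A, B2, C, D}) (h : S.card = 3) : Table 16 ({E} ∪ S)
  | deg12 (p : Cond) (hp : p = A ∨ p = B2 ∨ p = C ∨ p = D) : Table 12 {B1, E, p}
  | deg8 (S : Finset Cond) (hS : S ⊆ {A, B2, C, D}) (h : S.card = 2) : Table 8 ({E} ∪ S)
  | deg6 (p : Cond) (hp : p = A ∨ p = B2 ∨ p = E) : Table 6 {B1, p}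
  | deg4 : Table 4 {A, B2}
  | deg4' (p : Cond) (hp : p = A ∨ p = B2 ∨ p = C ∨ p = D) : Table 4 {E, p}
  | deg3 : Table 3 {B1}
  | deg2 (p : Cond) (hp : p = A ∨ p = B2 ∨ p = E) : Table 2 {p}
  | deg1 : Table 1 ∅

/-- The list of degrees in the table. -/
def degrees : Finset ℕ := {96, 48, 32, 24, 16, 12, 8, 6, 4, 3, 2, 1}

end DivisionFieldSeven

/-! Put `u = ω₁ + √θ₁ / 2`, so that `x₁² = b u` and `y₁² = x₁³ + b x₁`. The seventh division
polynomial of the curve is `b ^ 12 * psiSeven (x ^ 2 / b)`, and `u` is a root of `psiSeven`; hence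
`P = (x₁, y₁)` is a point of order 7. The curve has multiplication by `i`, namely `(x, y) ↦ (-x, i
y)`, and 7 is inert in `ℤ[i]`, so `P` generates the whole 7-torsion over `ℤ[i]`. Therefore `K₇ =
K(i, x₁, y₁)`, and this field contains `ζ₇`, because `ρ = i (ζ₇ - ζ₇⁻¹)` is a rational polynomial in
`u` (`IsSevenData.divisionField_eq`).

The tower `K ⊆ K(i) ⊆ K(i, ζ₇ + ζ₇⁻¹) ⊆ K(i, ζ₇) ⊆ K(i, ζ₇, √θ₁) ⊆ K(i, ζ₇, x₁) ⊆ K₇` has steps of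
degree 2, 3, 2, 2, 2, 2 or 1, according to the six conditions, so the degree is the product `weight`
(`IsSevenData.finrank_adjoin`). Any two consecutive steps among the last four form a potentially
cyclic quartic extension: if the lower one is nontrivial, so is the upper one
(`mem_of_sqrt_mem_sup`). Thus B2 ⇒ C ⇒ D ⇒ E, and the 20 sets of conditions allowed by this all
stand in the table.

To realize every degree, take `b = 1` over `ℚ`. There `[ℚ(i, ζ₇) : ℚ] = 12` forces A, B1, B2, hence
all six conditions and degree 96. The automorphisms fixing `i` act `ℤ[i]`-linearly on a cyclic
module, so they form an abelian subgroup of order 48. The Galois group then has a subgroup of each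
listed order, and the fixed fields are the required `K`. -/

namespace DivisionFieldSeven

/-! ### Identities in the field of 28th roots of unity and for the roots of `psiSeven`. -/

section Arithmetic

variable {L : Type*} [Field L]

/-- The polynomial of degree `12` with `ψ₇ = b ^ 12 * psiSeven (x ^ 2 / b)` for the seventh division
polynomial `ψ₇` of `y² = x³ + b x`. -/
def psiSeven (u : L) : L :=
  7 * u ^ 12 + 308 * u ^ 11 - 2954 * u ^ 10 - 19852 * u ^ 9 - 35231 * u ^ 8 - 82264 * u ^ 7
    - 111916 * u ^ 6 - 42168 * u ^ 5 + 15673 * u ^ 4 + 14756 * u ^ 3 + 1302 * u ^ 2 + 196 * u - 1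

/-- The generator `i (ζ - ζ⁻¹)` of the maximal real subfield of the field of `28`-th roots of
unity. -/
def realGen (i ζ : L) : L := i * (ζ - ζ ^ 6)

/-- The number `ω₁` as a polynomial in `realGen i ζ`. -/
def omegaReal (ρ : L) : L := 1 + 8 * ρ + 4 * ρ ^ 2 - 8 * ρ ^ 3 - 2 * ρ ^ 4 + 2 * ρ ^ 5

/-- The number `θ₁` as a polynomial in `realGen i ζ`. -/
def thetaReal (ρ : L) : L :=
  736 - 96 * ρ - 1120 * ρ ^ 2 + 384 * ρ ^ 3 + 336 * ρ ^ 4 - 992 / 7 * ρ ^ 5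

theorem cyclotomic_seven_relation {ζ : L} (h : IsPrimitiveRoot ζ 7) :
    ζ ^ 6 + ζ ^ 5 + ζ ^ 4 + ζ ^ 3 + ζ ^ 2 + ζ + 1 = 0 := by
  have h' := h.geom_sum_eq_zero (by norm_num)
  simp only [Finset.sum_range_succ, Finset.sum_range_zero] at h'
  linear_combination h'

theorem inv_eq_pow_six {ζ : L} (h : IsPrimitiveRoot ζ 7) : ζ⁻¹ = ζ ^ 6 :=
  inv_eq_of_mul_eq_one_right (by rw [← pow_succ', h.pow_eq_one])

theorem realGen_eq {i ζ : L}
    (hζ : ζ ^ 6 + ζ ^ 5 + ζ ^ 4 + ζ ^ 3 + ζ ^ 2 + ζ + 1 = 0) :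
    realGen i ζ = i + i * ζ ^ 5 + i * ζ ^ 4 + i * ζ ^ 3 + i * ζ ^ 2 + 2 * i * ζ := by
  unfold realGen
  linear_combination (-i) * hζ

theorem realGen_sq {i ζ : L} (hi : i ^ 2 = -1)
    (hζ : ζ ^ 6 + ζ ^ 5 + ζ ^ 4 + ζ ^ 3 + ζ ^ 2 + ζ + 1 = 0) :
    realGen i ζ ^ 2 = 2 - ζ ^ 5 - ζ ^ 2 := by
  rw [sq, realGen_eq hζ]
  linear_combination (1 + ζ ^ 10 + 2 * ζ ^ 9 + 3 * ζ ^ 8 + 4 * ζ ^ 7 + 7 * ζ ^ 6 + 8 * ζ ^ 5 +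
    7 * ζ ^ 4 + 6 * ζ ^ 3 + 6 * ζ ^ 2 + 4 * ζ) * hi + (-3 - ζ ^ 4 - ζ ^ 3 - ζ ^ 2 - ζ) * hζ

theorem realGen_pow_three {i ζ : L} (hi : i ^ 2 = -1)
    (hζ : ζ ^ 6 + ζ ^ 5 + ζ ^ 4 + ζ ^ 3 + ζ ^ 2 + ζ + 1 = 0) :
    realGen i ζ ^ 3 = 3 * i + 3 * i * ζ ^ 5 + 4 * i * ζ ^ 4 + 2 * i * ζ ^ 3 + 3 * i * ζ ^ 2 + 6 *
        i * ζ := by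
  rw [pow_succ, realGen_sq hi hζ, realGen_eq hζ]
  linear_combination (-i - i * ζ ^ 4 - i * ζ) * hζ

theorem realGen_pow_four {i ζ : L} (hi : i ^ 2 = -1)
    (hζ : ζ ^ 6 + ζ ^ 5 + ζ ^ 4 + ζ ^ 3 + ζ ^ 2 + ζ + 1 = 0) :
    realGen i ζ ^ 4 = 6 - 4 * ζ ^ 5 + ζ ^ 4 + ζ ^ 3 - 4 * ζ ^ 2 := by
  rw [pow_succ, realGen_pow_three hi hζ, realGen_eq hζ]
  linear_combination (3 + 3 * ζ ^ 10 + 7 * ζ ^ 9 + 9 * ζ ^ 8 + 12 * ζ ^ 7 + 21 * ζ ^ 6 + 25 *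
    ζ ^ 5 + 20 * ζ ^ 4 + 17 * ζ ^ 3 + 18 * ζ ^ 2 + 12 * ζ) * hi + (-9 - 3 * ζ ^ 4 - 4 * ζ ^ 3 -
    2 * ζ ^ 2 - 3 * ζ) * hζ

theorem realGen_pow_five {i ζ : L} (hi : i ^ 2 = -1)
    (hζ : ζ ^ 6 + ζ ^ 5 + ζ ^ 4 + ζ ^ 3 + ζ ^ 2 + ζ + 1 = 0) :
    realGen i ζ ^ 5 = 10 * i + 11 * i * ζ ^ 5 + 15 * i * ζ ^ 4 + 5 * i * ζ ^ 3 + 9 * i * ζ ^ 2 +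
        20 * i * ζ := by
  rw [pow_succ, realGen_pow_four hi hζ, realGen_eq hζ]
  linear_combination (-4 * i - 4 * i * ζ ^ 4 + i * ζ ^ 3 + i * ζ ^ 2 - 4 * i * ζ) * hζ

theorem realGen_pow_six {i ζ : L} (hi : i ^ 2 = -1)
    (hζ : ζ ^ 6 + ζ ^ 5 + ζ ^ 4 + ζ ^ 3 + ζ ^ 2 + ζ + 1 = 0) :
    realGen i ζ ^ 6 = 21 - 14 * ζ ^ 5 + 7 * ζ ^ 4 + 7 * ζ ^ 3 - 14 * ζ ^ 2 := by
  rw [pow_succ, realGen_pow_five hi hζ, realGen_eq hζ]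
  linear_combination (10 + 11 * ζ ^ 10 + 26 * ζ ^ 9 + 31 * ζ ^ 8 + 40 * ζ ^ 7 + 71 * ζ ^ 6 +
    85 * ζ ^ 5 + 64 * ζ ^ 4 + 53 * ζ ^ 3 + 59 * ζ ^ 2 + 40 * ζ) * hi + (-31 - 11 * ζ ^ 4 - 15 *
    ζ ^ 3 - 5 * ζ ^ 2 - 9 * ζ) * hζ

theorem realGen_relation {i ζ : L} (hi : i ^ 2 = -1)
    (hζ : ζ ^ 6 + ζ ^ 5 + ζ ^ 4 + ζ ^ 3 + ζ ^ 2 + ζ + 1 = 0) :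
    realGen i ζ ^ 6 - 7 * realGen i ζ ^ 4 + 14 * realGen i ζ ^ 2 - 7 = 0 := by
  rw [realGen_pow_six hi hζ, realGen_pow_four hi hζ, realGen_sq hi hζ]
  ring

theorem omegaOne_eq {i ζ : L} (hi : i ^ 2 = -1)
    (hζ : ζ ^ 6 + ζ ^ 5 + ζ ^ 4 + ζ ^ 3 + ζ ^ 2 + ζ + 1 = 0) :
    omegaOne i ζ = omegaReal (realGen i ζ) := by
  rw [omegaReal, realGen_pow_five hi hζ, realGen_pow_four hi hζ, realGen_pow_three hi hζ,
    realGen_sq hi hζ, realGen_eq hζ, omegaOne]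
  ring

theorem thetaOne_eq [CharZero L] {i ζ : L} (hi : i ^ 2 = -1)
    (hζ : ζ ^ 6 + ζ ^ 5 + ζ ^ 4 + ζ ^ 3 + ζ ^ 2 + ζ + 1 = 0) :
    thetaOne i ζ = thetaReal (realGen i ζ) := by
  rw [thetaReal, realGen_pow_five hi hζ, realGen_pow_four hi hζ, realGen_pow_three hi hζ,
    realGen_sq hi hζ, realGen_eq hζ, thetaOne]
  ring

/-- This is `u² - 2 ω u + (ω² - θ / 4) = 0` with the constant term reduced modulo the sextic
relation of `ρ`. -/
theorem quadratic_relation [CharZero L] {ρ : L} (hρ : ρ ^ 6 - 7 * ρ ^ 4 + 14 * ρ ^ 2 - 7 = 0) {u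
    : L}
    (hu : (u - omegaReal ρ) ^ 2 = thetaReal ρ / 4) :
    u ^ 2 - 2 * omegaReal ρ * u + (-15 - 4 / 7 * ρ ^ 5 - 4 * ρ ^ 4 + 8 * ρ ^ 3 + 16 * ρ ^ 2 - 16
        * ρ) = 0 := by
  unfold omegaReal thetaReal at *
  linear_combination hu + (-24 - 4 * ρ ^ 4 + 8 * ρ ^ 3 + 8 * ρ) * hρ

/-- The quadratic polynomial of `u` over `ℚ(ρ)` divides `psiSeven`; the coefficient of `hu` is the
cofactor, up to a multiple of the relation of `ρ`. -/
theorem psiSeven_eq_zero [CharZero L] {ρ : L} (hρ : ρ ^ 6 - 7 * ρ ^ 4 + 14 * ρ ^ 2 - 7 = 0) {u : L}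
    (hu : (u - omegaReal ρ) ^ 2 = thetaReal ρ / 4) :
    psiSeven u = 0 := by
  replace hu := quadratic_relation hρ hu
  unfold psiSeven
  unfold omegaReal at hu
  linear_combination (-49 + 7 * u ^ 10 + 322 * u ^ 9 + 28 * u ^ 9 * ρ ^ 5 - 28 * u ^ 9 * ρ ^ 4
    - 112 * u ^ 9 * ρ ^ 3 + 56 * u ^ 9 * ρ ^ 2 + 112 * u ^ 9 * ρ + 2499 * u ^ 8 + 228 * u ^ 8 *
    ρ ^ 5 + 1036 * u ^ 8 * ρ ^ 4 - 2072 * u ^ 8 * ρ ^ 3 - 5040 * u ^ 8 * ρ ^ 2 + 3920 * u ^ 8 *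
    ρ - 9128 * u ^ 7 + 2992 * u ^ 7 * ρ ^ 5 + 336 * u ^ 7 * ρ ^ 4 - 19712 * u ^ 7 * ρ ^ 3 - 1568
    * u ^ 7 * ρ ^ 2 + 26880 * u ^ 7 * ρ - 13090 * u ^ 6 + 2320 * u ^ 6 * ρ ^ 5 - 208 * u ^ 6 * ρ
    ^ 4 - 20384 * u ^ 6 * ρ ^ 3 - 448 * u ^ 6 * ρ ^ 2 + 35840 * u ^ 6 * ρ + 27020 * u ^ 5 + 1160
    * u ^ 5 * ρ ^ 5 + 7800 * u ^ 5 * ρ ^ 4 - 14560 * u ^ 5 * ρ ^ 3 - 47600 * u ^ 5 * ρ ^ 2 +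
    19040 * u ^ 5 * ρ + 13230 * u ^ 4 - 3016 * u ^ 4 * ρ ^ 5 - 920 * u ^ 4 * ρ ^ 4 + 6000 * u ^
    4 * ρ ^ 3 - 14112 * u ^ 4 * ρ ^ 2 - 5600 * u ^ 4 * ρ - 24360 * u ^ 3 - 6032 * u ^ 3 * ρ ^ 5
    - 10608 * u ^ 3 * ρ ^ 4 + 25728 * u ^ 3 * ρ ^ 3 + 42336 * u ^ 3 * ρ ^ 2 - 18816 * u ^ 3 * ρ
    + 987 * u ^ 2 + 1488 * u ^ 2 * ρ ^ 5 + 1136 * u ^ 2 * ρ ^ 4 - 5024 * u ^ 2 * ρ ^ 3 - 1984 *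
    u ^ 2 * ρ ^ 2 + 2688 * u ^ 2 * ρ + 2562 * u + 828 * u * ρ ^ 5 + 1476 * u * ρ ^ 4 - 2608 * u
    * ρ ^ 3 - 4488 * u * ρ ^ 2 + 1456 * u * ρ + 4 * ρ ^ 5 - 20 * ρ ^ 4 - 24 * ρ ^ 3 + 80 * ρ ^ 2
    + 16 * ρ) * hu + (736 / 7 + 672 * u ^ 10 + 112 * u ^ 10 * ρ ^ 4 - 224 * u ^ 10 * ρ ^ 3 - 224
    * u ^ 10 * ρ + 128 * u ^ 9 + 928 * u ^ 9 * ρ ^ 4 + 3328 * u ^ 9 * ρ ^ 3 - 9984 * u ^ 9 * ρ ^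
    2 - 3968 * u ^ 9 * ρ + 416 * u ^ 8 + 84688 / 7 * u ^ 8 * ρ ^ 4 - 9120 * u ^ 8 * ρ ^ 3 -
    42240 * u ^ 8 * ρ ^ 2 + 4192 * u ^ 8 * ρ + 38912 * u ^ 7 + 76928 / 7 * u ^ 7 * ρ ^ 4 + 2048
    * u ^ 7 * ρ ^ 3 - 74752 * u ^ 7 * ρ ^ 2 - 14336 * u ^ 7 * ρ + 38208 * u ^ 6 + 41760 / 7 * u
    ^ 6 * ρ ^ 4 + 250048 / 7 * u ^ 6 * ρ ^ 3 - 97280 * u ^ 6 * ρ ^ 2 - 114880 * u ^ 6 * ρ -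
    59136 * u ^ 5 - 79808 / 7 * u ^ 5 * ρ ^ 4 + 122368 / 7 * u ^ 5 * ρ ^ 3 + 9728 * u ^ 5 * ρ ^
    2 - 133888 * u ^ 5 * ρ - 23488 * u ^ 4 - 180960 / 7 * u ^ 4 * ρ ^ 4 - 216256 / 7 * u ^ 4 * ρ
    ^ 3 + 593408 / 7 * u ^ 4 * ρ ^ 2 + 43200 * u ^ 4 * ρ + 50176 * u ^ 3 + 17536 / 7 * u ^ 3 * ρ
    ^ 4 - 221184 / 7 * u ^ 3 * ρ ^ 3 - 72704 / 7 * u ^ 3 * ρ ^ 2 + 93184 * u ^ 3 * ρ - 3040 * u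
    ^ 2 + 29136 / 7 * u ^ 2 * ρ ^ 4 + 64352 / 7 * u ^ 2 * ρ ^ 3 - 74752 / 7 * u ^ 2 * ρ ^ 2 -
    100000 / 7 * u ^ 2 * ρ - 5504 * u + 3424 / 7 * u * ρ ^ 4 + 28416 / 7 * u * ρ ^ 3 + 7936 / 7
    * u * ρ ^ 2 - 62080 / 7 * u * ρ + 16 / 7 * ρ ^ 4 + 32 / 7 * ρ ^ 3 - 768 / 7 * ρ ^ 2 + 544 /
    7 * ρ) * hρ

/-- This is what puts `ζ` into the field generated by `i` and the x-coordinate of a single 7-torsion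
point. -/
theorem realGen_eq_eval [CharZero L] {ρ : L} (hρ : ρ ^ 6 - 7 * ρ ^ 4 + 14 * ρ ^ 2 - 7 = 0) {u : L}
    (hu : (u - omegaReal ρ) ^ 2 = thetaReal ρ / 4) :
    ρ = (-1513834 - 120197 * u ^ 11 - 5288948 * u ^ 10 + 50711479 * u ^ 9 + 341026182 * u ^ 8 +
      605468262 * u ^ 7 + 1412058928 * u ^ 6 + 1921350998 * u ^ 5 + 719776372 * u ^ 4 -
      279597857 * u ^ 3 - 261092300 * u ^ 2 - 24212685 * u) / 2 ^ 20 := by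
  replace hu := quadratic_relation hρ hu
  unfold omegaReal at hu
  linear_combination (22408869 / 524288 + 120197 / 1048576 * u ^ 9 + 2764671 / 524288 * u ^ 8
    + 120197 / 262144 * u ^ 8 * ρ ^ 5 - 120197 / 262144 * u ^ 8 * ρ ^ 4 - 120197 / 65536 * u ^ 8
    * ρ ^ 3 + 120197 / 131072 * u ^ 8 * ρ ^ 2 + 120197 / 65536 * u ^ 8 * ρ + 2682659 / 65536 * u
    ^ 7 + 979027 / 262144 * u ^ 7 * ρ ^ 5 + 4447009 / 262144 * u ^ 7 * ρ ^ 4 - 4447849 / 131072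
    * u ^ 7 * ρ ^ 3 - 5408725 / 65536 * u ^ 7 * ρ ^ 2 + 4207175 / 65536 * u ^ 7 * ρ - 39166897 /
    262144 * u ^ 6 + 12845523 / 262144 * u ^ 6 * ρ ^ 5 + 1453389 / 262144 * u ^ 6 * ρ ^ 4 -
    21159187 / 65536 * u ^ 6 * ρ ^ 3 - 3391381 / 131072 * u ^ 6 * ρ ^ 2 + 28856415 / 65536 * u ^
    6 * ρ - 112687183 / 524288 * u ^ 5 + 9983615 / 262144 * u ^ 5 * ρ ^ 5 - 914067 / 262144 * u
    ^ 5 * ρ ^ 4 - 43825523 / 131072 * u ^ 5 * ρ ^ 3 - 227409 / 32768 * u ^ 5 * ρ ^ 2 + 38506895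
    / 65536 * u ^ 5 * ρ + 58033563 / 131072 * u ^ 4 + 4930929 / 262144 * u ^ 4 * ρ ^ 5 +
    33471031 / 262144 * u ^ 4 * ρ ^ 4 - 3889501 / 16384 * u ^ 4 * ρ ^ 3 - 102145001 / 131072 * u
    ^ 4 * ρ ^ 2 + 20360809 / 65536 * u ^ 4 * ρ + 28689003 / 131072 * u ^ 3 - 12999655 / 262144 *
    u ^ 3 * ρ ^ 5 - 3875917 / 262144 * u ^ 3 * ρ ^ 4 + 13080417 / 131072 * u ^ 3 * ρ ^ 3 -
    15249717 / 65536 * u ^ 3 * ρ ^ 2 - 6199795 / 65536 * u ^ 3 * ρ - 104959351 / 262144 * u ^ 2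
    - 25980831 / 262144 * u ^ 2 * ρ ^ 5 - 45729105 / 262144 * u ^ 2 * ρ ^ 4 + 27763133 / 65536 *
    u ^ 2 * ρ ^ 3 + 91358141 / 131072 * u ^ 2 * ρ ^ 2 - 20392995 / 65536 * u ^ 2 * ρ + 14709009
    / 1048576 * u + 6392149 / 262144 * u * ρ ^ 5 + 4780031 / 262144 * u * ρ ^ 4 - 10675493 /
    131072 * u * ρ ^ 3 - 478793 / 16384 * u * ρ ^ 2 + 2821469 / 65536 * u * ρ + 1864523 / 131072
    * ρ ^ 5 + 3260297 / 131072 * ρ ^ 4 - 2972129 / 65536 * ρ ^ 3 - 2473865 / 32768 * ρ ^ 2 +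
    848715 / 32768 * ρ) * hu + (-1503973 / 16384 + 360591 / 32768 * u ^ 9 + 120197 / 65536 * u ^
    9 * ρ ^ 4 - 120197 / 32768 * u ^ 9 * ρ ^ 3 - 120197 / 32768 * u ^ 9 * ρ + 17381 / 8192 * u ^
    8 + 498099 / 32768 * u ^ 8 * ρ ^ 4 + 55797 / 1024 * u ^ 8 * ρ ^ 3 - 669669 / 4096 * u ^ 8 *
    ρ ^ 2 - 532371 / 8192 * u ^ 8 * ρ + 55347 / 8192 * u ^ 7 + 1623173 / 8192 * u ^ 7 * ρ ^ 4 -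
    2444455 / 16384 * u ^ 7 * ρ ^ 3 - 2834775 / 4096 * u ^ 7 * ρ ^ 2 + 1122553 / 16384 * u ^ 7 *
    ρ + 10439933 / 16384 * u ^ 6 + 20682707 / 114688 * u ^ 6 * ρ ^ 4 + 538867 / 16384 * u ^ 6 *
    ρ ^ 3 - 5016827 / 4096 * u ^ 6 * ρ ^ 2 - 3837759 / 16384 * u ^ 6 * ρ + 10274423 / 16384 * u
    ^ 5 + 22250059 / 229376 * u ^ 5 * ρ ^ 4 + 2399571 / 4096 * u ^ 5 * ρ ^ 3 - 6520595 / 4096 *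
    u ^ 5 * ρ ^ 2 - 3854549 / 2048 * u ^ 5 * ρ - 15899805 / 16384 * u ^ 4 - 2689583 / 14336 * u
    ^ 4 * ρ ^ 4 + 32963425 / 114688 * u ^ 4 * ρ ^ 3 + 667975 / 4096 * u ^ 4 * ρ ^ 2 - 35970931 /
    16384 * u ^ 4 * ρ - 3200775 / 8192 * u ^ 3 - 3044773 / 7168 * u ^ 3 * ρ ^ 4 - 58277855 /
    114688 * u ^ 3 * ρ ^ 3 + 5731259 / 4096 * u ^ 3 * ρ ^ 2 + 11676063 / 16384 * u ^ 3 * ρ +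
    13508635 / 16384 * u ^ 2 + 4691053 / 114688 * u ^ 2 * ρ ^ 4 - 59719937 / 114688 * u ^ 2 * ρ
    ^ 3 - 4741711 / 28672 * u ^ 2 * ρ ^ 2 + 25252779 / 16384 * u ^ 2 * ρ - 1493229 / 32768 * u +
    32495471 / 458752 * u * ρ ^ 4 + 34532955 / 229376 * u * ρ ^ 3 - 5199351 / 28672 * u * ρ ^ 2
    - 7517403 / 32768 * u * ρ + 1864523 / 229376 * ρ ^ 4 + 8155979 / 114688 * ρ ^ 3 + 239135 /
    14336 * ρ ^ 2 - 17586181 / 114688 * ρ) * hρ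

/-- `ω² - θ / 4` is the norm of `u` with respect to `√θ ↦ -√θ`. Once `i` is available, its product
with `θ` is a square, which is the condition for a cyclic quartic extension. -/
theorem thetaReal_mul_norm [CharZero L] {ρ : L} (hρ : ρ ^ 6 - 7 * ρ ^ 4 + 14 * ρ ^ 2 - 7 = 0) :
    -(thetaReal ρ * (omegaReal ρ ^ 2 - thetaReal ρ / 4))
      = (108 - 76 / 7 * ρ ^ 5 + 36 * ρ ^ 4 + 20 * ρ ^ 3 - 132 * ρ ^ 2 + 16 * ρ) ^ 2 := by
  unfold omegaReal thetaReal
  linear_combination (-123024 / 7 + 3968 / 7 * ρ ^ 9 - 17344 / 7 * ρ ^ 8 + 1152 * ρ ^ 7 +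
    44928 / 7 * ρ ^ 6 - 17408 / 7 * ρ ^ 5 - 62320 / 7 * ρ ^ 4 - 83168 / 7 * ρ ^ 3 + 185888 / 7 *
    ρ ^ 2 + 50464 / 7 * ρ) * hρ

/-- The same condition one step lower: `θ(ρ) θ(-ρ)` is the norm of `θ` with respect to `ρ ↦ -ρ`. -/
theorem thetaReal_mul_thetaReal_neg [CharZero L] {ρ : L} (hρ : ρ ^ 6 - 7 * ρ ^ 4 + 14 * ρ ^ 2 - 7
    = 0) :
    -(thetaReal ρ * thetaReal (-ρ) * ρ ^ 2) = (-96 - 16 * ρ ^ 4 + 80 * ρ ^ 2) ^ 2 := by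
  unfold thetaReal
  linear_combination (9216 / 7 + 984064 / 49 * ρ ^ 6 - 81152 * ρ ^ 4 + 77824 * ρ ^ 2) * hρ

/-- This and the four lemmas below are Bézout identities. They express that a root of `psiSeven`
does not come from a point of order 2, 3 or 4; all denominators are powers of 2. -/
theorem ne_zero_of_psiSeven [CharZero L] {u : L} (hψ : psiSeven u = 0) :
    u ≠ 0 := by
  intro hq
  unfold psiSeven at hψ
  apply one_ne_zero (α := L)
  linear_combination (-1) * hψ + (196 + 7 * u ^ 11 + 308 * u ^ 10 - 2954 * u ^ 9 - 19852 * u ^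
    8 - 35231 * u ^ 7 - 82264 * u ^ 6 - 111916 * u ^ 5 - 42168 * u ^ 4 + 15673 * u ^ 3 + 14756 *
    u ^ 2 + 1302 * u) * hq

theorem sub_one_ne_zero_of_psiSeven [CharZero L] {u : L} (hψ : psiSeven u = 0) :
    u - 1 ≠ 0 := by
  intro hq
  unfold psiSeven at hψ
  apply one_ne_zero (α := L)
  linear_combination (-1 / 262144) * hψ + (-262143 / 262144 + 7 / 262144 * u ^ 11 + 315 /
    262144 * u ^ 10 - 2639 / 262144 * u ^ 9 - 22491 / 262144 * u ^ 8 - 28861 / 131072 * u ^ 7 -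
    69993 / 131072 * u ^ 6 - 125951 / 131072 * u ^ 5 - 147035 / 131072 * u ^ 4 - 278397 / 262144
    * u ^ 3 - 263641 / 262144 * u ^ 2 - 262339 / 262144 * u) * hq

theorem add_one_ne_zero_of_psiSeven [CharZero L] {u : L} (hψ : psiSeven u = 0) :
    u + 1 ≠ 0 := by
  intro hq
  unfold psiSeven at hψ
  apply one_ne_zero (α := L)
  linear_combination (-1 / 4096) * hψ + (4095 / 4096 + 7 / 4096 * u ^ 11 + 301 / 4096 * u ^ 10
    - 3255 / 4096 * u ^ 9 - 16597 / 4096 * u ^ 8 - 9317 / 2048 * u ^ 7 - 31815 / 2048 * u ^ 6 -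
    24143 / 2048 * u ^ 5 + 3059 / 2048 * u ^ 4 + 9555 / 4096 * u ^ 3 + 5201 / 4096 * u ^ 2 -
    3899 / 4096 * u) * hq

theorem three_torsion_ne_zero_of_psiSeven [CharZero L] {u : L} (hψ : psiSeven u = 0) :
    3 * u ^ 2 + 6 * u - 1 ≠ 0 := by
  intro hq
  unfold psiSeven at hψ
  apply one_ne_zero (α := L)
  linear_combination (131949 / 16777216 + 15309 / 4194304 * u) * hψ + (-16909165 / 16777216 -
    35721 / 4194304 * u ^ 11 - 6309009 / 16777216 * u ^ 10 + 29660337 / 8388608 * u ^ 9 +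
    414400455 / 16777216 * u ^ 8 + 24476823 / 524288 * u ^ 7 + 900177327 / 8388608 * u ^ 6 +
    640755927 / 4194304 * u ^ 5 + 628602723 / 8388608 * u ^ 4 - 31327947 / 4194304 * u ^ 3 -
    320852973 / 16777216 * u ^ 2 - 37827111 / 8388608 * u) * hq

theorem four_torsion_ne_zero_of_psiSeven [CharZero L] {u : L} (hψ : psiSeven u = 0) :
    u ^ 2 + 6 * u + 1 ≠ 0 := by
  intro hq
  unfold psiSeven at hψ
  apply one_ne_zero (α := L)
  linear_combination (-40391 / 2097152 - 3465 / 1048576 * u) * hψ + (2056761 / 2097152 + 24255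
    / 1048576 * u ^ 11 + 2126117 / 2097152 * u ^ 10 - 5209001 / 524288 * u ^ 9 - 133999467 /
    2097152 * u ^ 8 - 55290039 / 524288 * u ^ 7 - 266072219 / 1048576 * u ^ 6 - 21383635 / 65536
    * u ^ 5 - 87410519 / 1048576 * u ^ 4 + 69304375 / 1048576 * u ^ 3 + 78475761 / 2097152 * u ^
    2 - 1107715 / 524288 * u) * hq

theorem sqrt_thetaReal_mul_norm_ne_zero [CharZero L] {ρ : L} (hρ : ρ ^ 6 - 7 * ρ ^ 4 + 14 * ρ ^ 2
    - 7 = 0) :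
    108 - 76 / 7 * ρ ^ 5 + 36 * ρ ^ 4 + 20 * ρ ^ 3 - 132 * ρ ^ 2 + 16 * ρ ≠ 0 := by
  intro h
  apply one_ne_zero (α := L)
  linear_combination (-21 / 2 - 9 / 4 * ρ ^ 5 - 21 / 4 * ρ ^ 4 + 29 / 4 * ρ ^ 3 + 18 * ρ ^ 2 - 17
      / 4 * ρ) * h - (1135 / 7 + 171 / 7 * ρ ^ 4 - 24 * ρ ^ 3 - 992 / 7 * ρ ^ 2 + 627 / 7 * ρ) * hρ

theorem sqrt_thetaReal_mul_thetaReal_neg_ne_zero [CharZero L] {ρ : L} (hρ : ρ ^ 6 - 7 * ρ ^ 4 +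
    14 * ρ ^ 2 - 7 = 0) :
    -96 - 16 * ρ ^ 4 + 80 * ρ ^ 2 ≠ 0 := by
  intro h
  apply one_ne_zero (α := L)
  linear_combination (-3 / 8 - 1 / 8 * ρ ^ 4 + 9 / 16 * ρ ^ 2) * h - (-5 + 2 * ρ ^ 2) * hρ

/-- Here `2 - ρ² = ζ² + ζ⁻²`. Applying `c ↦ c² - 2` twice gives `ζ⁸ + ζ⁻⁸ = ζ + ζ⁻¹`, while `-i ρ =
ζ - ζ⁻¹`; half the sum is `ζ`. -/
theorem zeta_eq [CharZero L] {i ζ : L} (hi : i ^ 2 = -1) (h : IsPrimitiveRoot ζ 7) :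
    ζ = (((2 - realGen i ζ ^ 2) ^ 2 - 2) ^ 2 - 2 - i * realGen i ζ) / 2 := by
  have h7 := h.pow_eq_one
  have ht : (2 - realGen i ζ ^ 2) ^ 2 - 2 = ζ ^ 4 + ζ ^ 3 := by
    rw [realGen_sq hi (cyclotomic_seven_relation h)]
    linear_combination (2 + ζ ^ 3) * h7
  rw [ht, realGen]
  linear_combination (-1 / 2 * (2 + ζ)) * h7 + 1 / 2 * (ζ - ζ ^ 6) * hi

theorem realGen_sq_eq {i ζ : L} (hi : i ^ 2 = -1) (h : IsPrimitiveRoot ζ 7) :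
    realGen i ζ ^ 2 = 4 - (ζ + ζ⁻¹) ^ 2 := by
  rw [inv_eq_pow_six h, realGen]
  linear_combination (ζ - ζ ^ 6) ^ 2 * hi + 4 * h.pow_eq_one

theorem real_cyclotomic_relation {ζ : L} (h : IsPrimitiveRoot ζ 7) :
    (ζ + ζ⁻¹) ^ 3 + (ζ + ζ⁻¹) ^ 2 - 2 * (ζ + ζ⁻¹) - 1 = 0 := by
  have hζ := cyclotomic_seven_relation h
  rw [inv_eq_pow_six h]
  linear_combination (-1 + ζ ^ 12 - ζ ^ 11 + 3 * ζ ^ 7 - 2 * ζ ^ 6 - ζ ^ 4 + 3 * ζ ^ 2 - ζ) * hζ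

end Arithmetic

open WeierstrassCurve.Affine

/-! ### Multiples of a point and the seventh division polynomial. -/

section Points

variable {L : Type*} [Field L] {β : L}

theorem curve_equation_iff {x y : L} :
    (curve β).toAffine.Equation x y ↔ y ^ 2 = x ^ 3 + β * x := by
  rw [WeierstrassCurve.Affine.equation_iff]
  simp [curve]

theorem curve_negY (x y : L) : (curve β).toAffine.negY x y = -y := by
  simp [WeierstrassCurve.Affine.negY, curve]

theorem curve_nonsingular [CharZero L] {x y : L} (h : y ^ 2 = x ^ 3 + β * x) (hy : y ≠ 0) :
    (curve β).toAffine.Nonsingular x y := by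
  rw [WeierstrassCurve.Affine.nonsingular_iff]
  refine ⟨curve_equation_iff.2 h, Or.inr ?_⟩
  simp only [curve, zero_mul, sub_zero]
  intro h'
  exact hy (by linear_combination (1 / 2 : L) * h')

/-- The numerator is, up to sign, the third division polynomial: it vanishes exactly when `2P` and
`P` have the same x-coordinate. -/
theorem doubleX_sub {x y : L} (he : y ^ 2 = x ^ 3 + β * x) (hy : y ≠ 0) [CharZero L] :
    (x ^ 2 - β) ^ 2 / (4 * y ^ 2) - x
      = -(3 * x ^ 4 + 6 * β * x ^ 2 - β ^ 2) / (4 * y ^ 2) := by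
  field_simp
  linear_combination (-4 * x) * he

/-- The seventh division polynomial of `y² = x³ + β x`. -/
def divPolySeven {R : Type*} [CommRing R] (β x : R) : R :=
  7 * x ^ 24 + 308 * β * x ^ 22 - 2954 * β ^ 2 * x ^ 20 - 19852 * β ^ 3 * x ^ 18 - 35231 * β ^
    4 * x ^ 16 - 82264 * β ^ 5 * x ^ 14 - 111916 * β ^ 6 * x ^ 12 - 42168 * β ^ 7 * x ^ 10 +
    15673 * β ^ 8 * x ^ 8 + 14756 * β ^ 9 * x ^ 6 + 1302 * β ^ 10 * x ^ 4 + 196 * β ^ 11 * x ^ 2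
    - β ^ 12

theorem divPolySeven_eq (hβ : β ≠ 0) (x : L) :
    divPolySeven β x = β ^ 12 * psiSeven (x ^ 2 / β) := by
  unfold divPolySeven psiSeven
  field_simp

/-- The two sides are the x-coordinates of `3P` and `4P = 2(2P)`; their difference has numerator
`divPolySeven`. -/
theorem tripleX_eq_quadrupleX_iff [CharZero L] {x y : L} (he : y ^ 2 = x ^ 3 + β * x) (hy : y ≠ 0)
    (h3 : 3 * x ^ 4 + 6 * β * x ^ 2 - β ^ 2 ≠ 0)
    (h4 : (x ^ 2 - β) * (x ^ 4 + 6 * β * x ^ 2 + β ^ 2) / (8 * y ^ 3) ≠ 0) :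
    x * (x ^ 4 - 6 * β * x ^ 2 - 3 * β ^ 2) ^ 2 / (3 * x ^ 4 + 6 * β * x ^ 2 - β ^ 2) ^ 2
      = (((x ^ 2 - β) ^ 2 / (4 * y ^ 2)) ^ 2 - β) ^ 2
        / (4 * ((x ^ 2 - β) * (x ^ 4 + 6 * β * x ^ 2 + β ^ 2) / (8 * y ^ 3)) ^ 2)
      ↔ divPolySeven β x = 0 := by
  rw [div_eq_div_iff (by simpa using h3) (by simpa using h4)]
  have key : x * (x ^ 4 - 6 * β * x ^ 2 - 3 * β ^ 2) ^ 2
      * (4 * ((x ^ 2 - β) * (x ^ 4 + 6 * β * x ^ 2 + β ^ 2) / (8 * y ^ 3)) ^ 2)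
      - (((x ^ 2 - β) ^ 2 / (4 * y ^ 2)) ^ 2 - β) ^ 2 * (3 * x ^ 4 + 6 * β * x ^ 2 - β ^ 2) ^ 2
      = divPolySeven β x / (256 * y ^ 8) := by
    have h2 : y ^ 4 = (x ^ 3 + β * x) ^ 2 := by rw [← he]; ring
    unfold divPolySeven
    field_simp
    rw [h2, he]
    ring
  rw [← sub_eq_zero, key, div_eq_zero_iff, or_iff_left (by simp [hy])]

theorem Y_ne_zero_of_psiSeven [CharZero L] (hβ : β ≠ 0) {x y u : L} (hu : x ^ 2 = β * u)
    (hψ : psiSeven u = 0) (he : y ^ 2 = x ^ 3 + β * x) : y ≠ 0 := by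
  have hx : x ≠ 0 := fun hx => by
    rw [hx, zero_pow two_ne_zero, eq_comm, mul_eq_zero] at hu
    exact hu.elim hβ (ne_zero_of_psiSeven hψ)
  intro hy
  have : x * β * (u + 1) = 0 := by
    linear_combination (-x) * hu - he + y * hy
  simp [hx, hβ, add_one_ne_zero_of_psiSeven hψ] at this

variable [DecidableEq L]

theorem two_smul_some [CharZero L] {x y : L} (h : (curve β).toAffine.Nonsingular x y) (hy : y ≠ 0) :
    ∃ h' : (curve β).toAffine.Nonsingular ((x ^ 2 - β) ^ 2 / (4 * y ^ 2))
      ((x ^ 2 - β) * (x ^ 4 + 6 * β * x ^ 2 + β ^ 2) / (8 * y ^ 3)),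
      2 • Point.some x y h = Point.some _ _ h' := by
  have he := curve_equation_iff.1 h.1
  have hne : y ≠ (curve β).toAffine.negY x y := by
    rw [curve_negY]
    intro h'
    exact hy (by linear_combination (1 / 2 : L) * h')
  have hs : (curve β).toAffine.slope x x y y = (3 * x ^ 2 + β) / (2 * y) := by
    rw [slope_of_Y_ne rfl hne, curve_negY]
    simp only [curve]
    ring
  have hX : (curve β).toAffine.addX x x ((curve β).toAffine.slope x x y y)
      = (x ^ 2 - β) ^ 2 / (4 * y ^ 2) := by
    rw [hs, addX]
    simp only [curve]
    field_simp
    linear_combination (-32 * x) * he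
  have hY : (curve β).toAffine.addY x x y ((curve β).toAffine.slope x x y y)
      = (x ^ 2 - β) * (x ^ 4 + 6 * β * x ^ 2 + β ^ 2) / (8 * y ^ 3) := by
    rw [addY, curve_negY, negAddY, hX, hs]
    field_simp
    linear_combination (-64 * y ^ 2 + 32 * x ^ 3 - 32 * β * x) * he
  have h2 : 2 • Point.some x y h = Point.some _ _ (nonsingular_add h h fun h' => hne h'.2) := by
    rw [two_smul, Point.add_self_of_Y_ne hne]
  rw [← hX, ← hY]
  exact ⟨_, h2⟩

theorem three_smul_some [CharZero L] {x y : L} (h : (curve β).toAffine.Nonsingular x y)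
    (hy : y ≠ 0) (h3 : 3 * x ^ 4 + 6 * β * x ^ 2 - β ^ 2 ≠ 0) :
    ∃ (Y : L) (h' : (curve β).toAffine.Nonsingular
      (x * (x ^ 4 - 6 * β * x ^ 2 - 3 * β ^ 2) ^ 2 / (3 * x ^ 4 + 6 * β * x ^ 2 - β ^ 2) ^ 2) Y),
      3 • Point.some x y h = Point.some _ _ h' := by
  have he := curve_equation_iff.1 h.1
  obtain ⟨h', h2⟩ := two_smul_some h hy
  have hd := doubleX_sub he hy
  have hX : (x ^ 2 - β) ^ 2 / (4 * y ^ 2) ≠ x := by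
    rw [← sub_ne_zero, hd]
    exact div_ne_zero (neg_ne_zero.2 h3) (by simp [hy])
  have hs : (curve β).toAffine.slope ((x ^ 2 - β) ^ 2 / (4 * y ^ 2)) x
      ((x ^ 2 - β) * (x ^ 4 + 6 * β * x ^ 2 + β ^ 2) / (8 * y ^ 3)) y
      = (7 * x ^ 6 + 11 * β * x ^ 4 + 13 * β ^ 2 * x ^ 2 + β ^ 3)
        / (2 * y * (3 * x ^ 4 + 6 * β * x ^ 2 - β ^ 2)) := by
    rw [slope_of_X_ne hX, hd]
    generalize 3 * x ^ 4 + 6 * β * x ^ 2 - β ^ 2 = D at h3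
    field_simp
    linear_combination (64 * y ^ 2 + 64 * x ^ 3 + 64 * β * x) * he
  have hX3 : (curve β).toAffine.addX ((x ^ 2 - β) ^ 2 / (4 * y ^ 2)) x
      ((curve β).toAffine.slope ((x ^ 2 - β) ^ 2 / (4 * y ^ 2)) x
        ((x ^ 2 - β) * (x ^ 4 + 6 * β * x ^ 2 + β ^ 2) / (8 * y ^ 3)) y)
      = x * (x ^ 4 - 6 * β * x ^ 2 - 3 * β ^ 2) ^ 2
        / (3 * x ^ 4 + 6 * β * x ^ 2 - β ^ 2) ^ 2 := by
    rw [hs, addX]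
    simp only [curve]
    generalize hD : 3 * x ^ 4 + 6 * β * x ^ 2 - β ^ 2 = D at h3
    field_simp
    rw [← hD]
    linear_combination (-16 * x * (3 * x ^ 4 + 6 * β * x ^ 2 - β ^ 2) ^ 2
      - 16 * x * (x ^ 4 - 6 * β * x ^ 2 - 3 * β ^ 2) ^ 2) * he
  have h3P : 3 • Point.some x y h = Point.some _ _ h' + Point.some x y h := by
    rw [← h2, ← succ_nsmul]
  rw [← hX3, h3P, Point.add_of_X_ne hX]
  exact ⟨_, _, rfl⟩

/-- Equal x-coordinates mean `3P = 4P` or `3P = -4P`. The former would give `P = 0`, the latter is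
`7P = 0`. -/
theorem seven_smul_eq_zero_iff [CharZero L] {x y : L} (h : (curve β).toAffine.Nonsingular x y)
    (hy : y ≠ 0) (h3 : 3 * x ^ 4 + 6 * β * x ^ 2 - β ^ 2 ≠ 0)
    (h4 : (x ^ 2 - β) * (x ^ 4 + 6 * β * x ^ 2 + β ^ 2) / (8 * y ^ 3) ≠ 0) :
    7 • Point.some x y h = 0 ↔ divPolySeven β x = 0 := by
  have he := curve_equation_iff.1 h.1
  obtain ⟨h₂, e₂⟩ := two_smul_some h hy
  obtain ⟨Y, h₃, e₃⟩ := three_smul_some h hy h3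
  obtain ⟨h₄, e₄⟩ := two_smul_some h₂ h4
  rw [← tripleX_eq_quadrupleX_iff he hy h3 h4, Point.X_eq_iff (h₁ := h₃) (h₂ := h₄), ← e₄, ← e₃,
    ← e₂, smul_smul]
  constructor
  · intro h7
    right
    rw [eq_neg_iff_add_eq_zero, ← add_nsmul]
    exact h7
  · rintro (h' | h')
    · rw [show (2 * 2) = 3 + 1 from rfl, add_nsmul, one_nsmul] at h'
      simp at h'
    · rw [eq_neg_iff_add_eq_zero, ← add_nsmul] at h'
      exact h'

end Points

/-! ### The 7-torsion as a cyclic module over `ℤ[i]`. -/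

section Torsion

variable {L : Type*} [Field L] {β : L} [DecidableEq L]

theorem two_smul_of_Y_eq_zero {x y : L} (h : (curve β).toAffine.Nonsingular x y) (hy : y = 0) :
    2 • Point.some x y h = 0 := by
  rw [two_smul, Point.add_self_of_Y_eq]
  rw [curve_negY, hy, neg_zero]

theorem divPolySeven_of_seven_smul [CharZero L] {x y : L}
    (h : (curve β).toAffine.Nonsingular x y) (h7 : 7 • Point.some x y h = 0) :
    divPolySeven β x = 0 := by
  have hne := Point.some_ne_zero h
  have h2 : 2 • Point.some x y h ≠ 0 := fun h2 => hne <| by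
    rw [show 7 = 2 * 3 + 1 from rfl, add_nsmul, mul_nsmul, h2, nsmul_zero, zero_add, one_nsmul]
        at h7
    exact h7
  have hy : y ≠ 0 := fun hy => h2 (two_smul_of_Y_eq_zero h hy)
  obtain ⟨h₂, e₂⟩ := two_smul_some h hy
  refine (seven_smul_eq_zero_iff h hy (fun h3 => ?_) (fun h4 => ?_)).1 h7
  -- A root of the third division polynomial would make `3P = 0`, against `7P = 0` and `P ≠ 0`.
  · have hX := doubleX_sub (curve_equation_iff.1 h.1) hy
    rw [h3, neg_zero, zero_div, sub_eq_zero, Point.X_eq_iff (h₁ := h₂) (h₂ := h), ← e₂] at hX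
    rcases hX with hX | hX
    · rw [two_nsmul] at hX
      simp at hX
    · rw [eq_neg_iff_add_eq_zero, ← succ_nsmul] at hX
      rw [show 7 = 3 * 2 + 1 from rfl, add_nsmul, mul_nsmul, hX, nsmul_zero, zero_add,
        one_nsmul] at h7
      exact hne h7
  -- A vanishing y-coordinate of `2P` gives `4P = 0`, so `0 = 8P = 7P + P = P`.
  · have e₄ := two_smul_of_Y_eq_zero h₂ h4
    rw [← e₂, smul_smul] at e₄
    have e : (2 : ℕ) • ((2 * 2) • Point.some x y h) = 7 • Point.some x y h + Point.some x y h := by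
      rw [smul_smul, ← succ_nsmul]
      rfl
    rw [e₄, h7, nsmul_zero, zero_add] at e
    exact hne e.symm

theorem seven_smul_of_psiSeven [CharZero L] (hβ : β ≠ 0) {x y u : L} (hu : x ^ 2 = β * u)
    (hψ : psiSeven u = 0) (h : (curve β).toAffine.Nonsingular x y) :
    7 • Point.some x y h = 0 := by
  have he := curve_equation_iff.1 h.1
  have hy := Y_ne_zero_of_psiSeven hβ hu hψ he
  have hx4 : x ^ 4 = β ^ 2 * u ^ 2 := by rw [← mul_pow, ← hu]; ring
  rw [seven_smul_eq_zero_iff h hy, divPolySeven_eq hβ, hu, mul_div_cancel_left₀ _ hβ, hψ, mul_zero]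
  · rw [hx4, hu, show 3 * (β ^ 2 * u ^ 2) + 6 * β * (β * u) - β ^ 2
      = β ^ 2 * (3 * u ^ 2 + 6 * u - 1) by ring]
    exact mul_ne_zero (pow_ne_zero 2 hβ) (three_torsion_ne_zero_of_psiSeven hψ)
  · rw [hx4, hu, show (β * u - β) * (β ^ 2 * u ^ 2 + 6 * β * (β * u) + β ^ 2)
      = β ^ 3 * ((u - 1) * (u ^ 2 + 6 * u + 1)) by ring]
    have := sub_one_ne_zero_of_psiSeven hψ
    have := four_torsion_ne_zero_of_psiSeven hψ
    exact div_ne_zero (by simp_all) (by simp_all)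

-- There are at most 24 x-coordinates, at most two points over each, and the point at infinity: `24
-- * 2 + 1 = 49`.
open Polynomial in
theorem finite_seven_torsion [CharZero L] (β : L) :
    {P : (curve β).toAffine.Point | 7 • P = 0}.Finite ∧
      {P : (curve β).toAffine.Point | 7 • P = 0}.ncard ≤ 49 := by
  set p : L[X] := divPolySeven (C β) X with hp
  have hdeg : p.natDegree = 24 := by
    rw [hp, divPolySeven]
    compute_degree!
  have hp0 : p ≠ 0 := by
    rintro h
    rw [h] at hdeg
    simp at hdeg
  have heval (x : L) : p.eval x = divPolySeven β x := by
    simp [hp, divPolySeven]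
  let S : Finset (L × L) := p.roots.toFinset.biUnion fun x =>
    (nthRoots 2 (x ^ 3 + β * x)).toFinset.image fun y => (x, y)
  have hS : S.card ≤ 24 * 2 := by
    refine (Finset.card_biUnion_le_card_mul _ _ 2 fun x _ => ?_).trans ?_
    · exact Finset.card_image_le.trans ((Multiset.toFinset_card_le _).trans (card_nthRoots _ _))
    · exact Nat.mul_le_mul_right _ ((Multiset.toFinset_card_le _).trans
        ((card_roots' p).trans hdeg.le))
  let f : (curve β).toAffine.Point → Option (L × L)
    | .zero => none
    | .some x y _ => some (x, y)
  have hf : Function.Injective f := by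
    rintro (_ | ⟨x, y, h⟩) (_ | ⟨x', y', h'⟩) e
    · rfl
    · simp [f] at e
    · simp [f] at e
    · simp only [f, Option.some.injEq, Prod.mk.injEq] at e
      obtain ⟨rfl, rfl⟩ := e
      rfl
  have hmaps : ∀ P ∈ {P : (curve β).toAffine.Point | 7 • P = 0},
      f P ∈ (Finset.insertNone S : Set (Option (L × L))) := by
    rintro (_ | ⟨x, y, h⟩) h7
    · simp [f]
    · have hx := divPolySeven_of_seven_smul h h7
      have he := curve_equation_iff.1 h.1
      simp only [f, S, Finset.mem_coe, Finset.some_mem_insertNone, Finset.mem_biUnion,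
        Finset.mem_image, Multiset.mem_toFinset]
      exact ⟨x, by rw [mem_roots hp0, IsRoot, heval, hx], y, by
        rw [mem_nthRoots two_pos, he], rfl⟩
  refine ⟨Set.Finite.of_injOn hmaps hf.injOn (Finset.finite_toSet _), ?_⟩
  refine (Set.ncard_le_ncard_of_injOn f hmaps hf.injOn (Finset.finite_toSet _)).trans ?_
  rw [Set.ncard_coe_finset, Finset.card_insertNone]
  omega

/-- The endomorphism `(x, y) ↦ (-x, i y)` of the points of `y² = x³ + β x`. -/
def mulI {i : L} (hi : i ^ 2 = -1) : (curve β).toAffine.Point →+ (curve β).toAffine.Point where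
  toFun
    | .zero => .zero
    | .some x y h => .some (-x) (i * y) <| by
      have hi0 : i ≠ 0 := by rintro rfl; simp at hi
      rw [WeierstrassCurve.Affine.nonsingular_iff] at h ⊢
      rw [curve_equation_iff] at h ⊢
      refine ⟨by linear_combination i ^ 2 * h.1 + (x ^ 3 + β * x) * hi, ?_⟩
      simpa only [curve, zero_mul, sub_zero, mul_zero, neg_sq, add_zero, ← mul_neg, ne_eq,
        mul_right_inj' hi0] using h.2
  map_zero' := rfl
  map_add' := by
    have hi0 : i ≠ 0 := by rintro rfl; simp at hi
    have hinv : i⁻¹ = -i := inv_eq_of_mul_eq_one_right (by linear_combination -hi)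
    rintro (_ | ⟨x₁, y₁, h₁⟩) (_ | ⟨x₂, y₂, h₂⟩)
    · rfl
    · rfl
    · rfl
    · by_cases hxy : x₁ = x₂ ∧ y₁ = (curve β).toAffine.negY x₂ y₂
      · rw [Point.add_of_Y_eq hxy.1 hxy.2]
        dsimp only
        rw [Point.add_of_Y_eq (by rw [hxy.1]) (by rw [hxy.2, curve_negY, curve_negY, mul_neg])]
        rfl
      · have hxy' : ¬(-x₁ = -x₂ ∧ i * y₁ = (curve β).toAffine.negY (-x₂) (i * y₂)) := by
          rw [curve_negY, ← mul_neg, neg_inj, mul_right_inj' hi0]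
          rwa [curve_negY] at hxy
        have hs : (curve β).toAffine.slope (-x₁) (-x₂) (i * y₁) (i * y₂)
            = -i * (curve β).toAffine.slope x₁ x₂ y₁ y₂ := by
          by_cases hx : x₁ = x₂
          · have hy : y₁ ≠ (curve β).toAffine.negY x₂ y₂ := fun hy => hxy ⟨hx, hy⟩
            have hy' : i * y₁ ≠ (curve β).toAffine.negY (-x₂) (i * y₂) :=
              fun hy => hxy' ⟨by rw [hx], hy⟩
            rw [slope_of_Y_ne hx hy, slope_of_Y_ne (by rw [hx]) hy', curve_negY, curve_negY]
            simp only [curve]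
            rw [← mul_neg, ← mul_sub, div_eq_mul_inv, mul_inv, hinv]
            ring
          · rw [slope_of_X_ne hx, slope_of_X_ne (by simpa using hx), ← mul_sub,
              show -x₁ - -x₂ = -(x₁ - x₂) by ring, div_neg, mul_div_assoc, neg_mul]
        rw [Point.add_some hxy]
        dsimp only
        rw [Point.add_some hxy']
        simp only [Point.some.injEq, hs, addY, curve_negY, negAddY, addX]
        generalize (curve β).toAffine.slope x₁ x₂ y₁ y₂ = ℓ
        simp only [curve]
        constructor
        · linear_combination (-ℓ ^ 2) * hi
        · linear_combination (-i * ℓ ^ 3) * hi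

theorem mulI_mulI {i : L} (hi : i ^ 2 = -1) (P : (curve β).toAffine.Point) :
    mulI hi (mulI hi P) = -P := by
  rcases P with _ | ⟨x, y, h⟩
  · rfl
  · simp only [mulI, AddMonoidHom.coe_mk, ZeroHom.coe_mk, Point.neg_some, Point.some.injEq,
      neg_neg, curve_negY, true_and]
    linear_combination y * hi

/-- The points of `y² = x³ + β x` with coordinates in a subfield. -/
def pointsOver (M : Subfield L) (hβ : β ∈ M) : AddSubgroup (curve β).toAffine.Point where
  carrier := {P | ∀ x y h, P = .some x y h → x ∈ M ∧ y ∈ M}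
  zero_mem' := by
    intro x y h e
    cases e
  neg_mem' := by
    rintro (_ | ⟨x, y, h⟩) hP x' y' h' e
    · cases e
    · rw [Point.neg_some, Point.some.injEq, curve_negY] at e
      obtain ⟨hx, hy⟩ := hP x y h rfl
      exact ⟨e.1 ▸ hx, e.2 ▸ neg_mem hy⟩
  add_mem' := by
    rintro (_ | ⟨x₁, y₁, h₁⟩) (_ | ⟨x₂, y₂, h₂⟩) hP hQ
    · exact hP
    · exact hQ
    · exact hP
    · obtain ⟨hx₁, hy₁⟩ := hP _ _ _ rfl
      obtain ⟨hx₂, hy₂⟩ := hQ _ _ _ rfl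
      intro x y h e
      by_cases hxy : x₁ = x₂ ∧ y₁ = (curve β).toAffine.negY x₂ y₂
      · rw [Point.add_of_Y_eq hxy.1 hxy.2] at e
        cases e
      · rw [Point.add_some hxy, Point.some.injEq] at e
        have hs : (curve β).toAffine.slope x₁ x₂ y₁ y₂ ∈ M := by
          by_cases hx : x₁ = x₂
          · rw [slope_of_Y_ne hx fun hy => hxy ⟨hx, hy⟩, curve_negY]
            have h3 : (3 : L) ∈ M := ofNat_mem M 3
            simp only [curve, mul_zero, zero_mul, add_zero, sub_zero]
            exact div_mem (add_mem (mul_mem h3 (pow_mem hx₁ 2)) hβ) (sub_mem hy₁ (neg_mem hy₁))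
          · rw [slope_of_X_ne hx]
            exact div_mem (sub_mem hy₁ hy₂) (sub_mem hx₁ hx₂)
        have hX : (curve β).toAffine.addX x₁ x₂ ((curve β).toAffine.slope x₁ x₂ y₁ y₂) ∈ M := by
          generalize (curve β).toAffine.slope x₁ x₂ y₁ y₂ = ℓ at hs
          simp only [addX, curve, zero_mul, add_zero, sub_zero]
          exact sub_mem (sub_mem (pow_mem hs 2) hx₁) hx₂
        refine ⟨e.1 ▸ hX, e.2 ▸ ?_⟩
        rw [addY, curve_negY, negAddY]
        exact neg_mem (add_mem (mul_mem hs (sub_mem hX hx₁)) hy₁)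

theorem dvd_of_seven_dvd_sq_add_sq {a c : ℤ} (h : (7 : ℤ) ∣ a ^ 2 + c ^ 2) : 7 ∣ a ∧ 7 ∣ c := by
  -- Here `-1` is not a square modulo 7, that is, 7 is inert in `ℤ[i]`.
  have key : ∀ a c : ZMod 7, a ^ 2 + c ^ 2 = 0 → a = 0 ∧ c = 0 := by decide
  have := key a c (by exact_mod_cast (ZMod.intCast_zmod_eq_zero_iff_dvd _ 7).2 h)
  rwa [ZMod.intCast_zmod_eq_zero_iff_dvd, ZMod.intCast_zmod_eq_zero_iff_dvd] at this

/-- A group with an endomorphism of square `-1` and at most `49` elements of order dividing `7` has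
`7`-torsion generated over `ℤ[i]` by any nonzero element. -/
theorem exists_eq_smul_add_smul {G : Type*} [AddCommGroup G] (J : G →+ G)
    (hJ : ∀ Q, J (J Q) = -Q) (hfin : {Q : G | 7 • Q = 0}.Finite)
    (hcard : {Q : G | 7 • Q = 0}.ncard ≤ 49) {P : G} (hP : P ≠ 0) (h7 : 7 • P = 0)
    {Q : G} (hQ : 7 • Q = 0) : ∃ m n : ℕ, Q = m • P + n • J P := by
  have : Fact (Nat.Prime 7) := ⟨by norm_num⟩
  have hord : addOrderOf P = 7 := addOrderOf_eq_prime h7 hP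
  let f : Fin 7 × Fin 7 → G := fun m => (m.1 : ℕ) • P + (m.2 : ℕ) • J P
  have hf : Function.Injective f := by
    rintro ⟨m, n⟩ ⟨m', n'⟩ e
    simp only [f] at e
    obtain ⟨a, ha⟩ : ∃ a : ℤ, a = m - m' := ⟨_, rfl⟩
    obtain ⟨c, hc⟩ : ∃ c : ℤ, c = n - n' := ⟨_, rfl⟩
    have h0 : a • P + c • J P = 0 := by
      rw [ha, hc, sub_smul, sub_smul]
      simp only [natCast_zsmul]
      rw [← sub_eq_zero] at e
      rw [← e]
      abel
    -- Apply the conjugate `a - c J` to the relation `(a + c J) P = 0`.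
    have h1 : (a ^ 2 + c ^ 2) • P = 0 := by
      have h2 : a • (a • P + c • J P) - c • J (a • P + c • J P) = 0 := by
        rw [h0, map_zero, smul_zero, smul_zero, sub_zero]
      rw [map_add, map_zsmul, map_zsmul, hJ] at h2
      rw [← h2]
      module
    rw [← addOrderOf_dvd_iff_zsmul_eq_zero, hord] at h1
    obtain ⟨⟨k, hk⟩, ⟨l, hl⟩⟩ := dvd_of_seven_dvd_sq_add_sq h1
    ext <;> simp only <;> omega
  have hsub : Set.range f ⊆ {Q : G | 7 • Q = 0} := by
    rintro _ ⟨⟨m, n⟩, rfl⟩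
    simp only [f, Set.mem_ofPred_eq, smul_add, smul_comm 7, h7, ← map_nsmul J 7 P, map_zero,
      smul_zero, add_zero]
  have hcard' : (Set.range f).ncard = 49 := by
    rw [← Set.image_univ, Set.ncard_image_of_injective _ hf, Set.ncard_univ]
    simp
  -- The 49 distinct combinations already exhaust the 7-torsion.
  have heq := Set.eq_of_subset_of_ncard_le hsub (by rw [hcard']; exact hcard) hfin
  obtain ⟨⟨m, n⟩, h⟩ := heq.symm ▸ (show Q ∈ {Q : G | 7 • Q = 0} from hQ)
  exact ⟨m, n, h.symm⟩

end Torsion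

open IntermediateField

/-! ### Degrees of quadratic and cubic steps, and the cyclic quartic criterion. -/

section Tower

variable {K L : Type*} [Field K] [Field L] [Algebra K L]

theorem finrank_sup_adjoin_simple (F : IntermediateField K L) {r : L} {n : ℕ}
    (hr_int : IsIntegral F r) (hn : (minpoly F r).natDegree = n) :
    Module.finrank K ↥(F ⊔ K⟮r⟯) = Module.finrank K F * n := by
  rw [← restrictScalars_adjoin_eq_sup, ← hn, ← adjoin.finrank hr_int]
  exact (Module.finrank_mul_finrank K F F⟮r⟯).symm

theorem isIntegral_of_sq_mem (F : IntermediateField K L) {r : L} (hr : r ^ 2 ∈ F) :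
    IsIntegral F r :=
  IsIntegral.of_pow two_pos (isIntegral_algebraMap (R := F) (x := (⟨r ^ 2, hr⟩ : F)))

open Polynomial in
theorem finrank_sup_sqrt (F : IntermediateField K L) {r : L} (hr : r ^ 2 ∈ F) {P : Prop}
    [Decidable P] (hP : P ↔ r ∉ F) :
    Module.finrank K ↥(F ⊔ K⟮r⟯) = Module.finrank K F * (if P then 2 else 1) := by
  split_ifs with h <;> rw [hP] at h
  swap
  · rw [sup_eq_left.2 (adjoin_simple_le_iff.2 (not_not.1 h)), mul_one]
  · have hr_int := isIntegral_of_sq_mem F hr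
    refine finrank_sup_adjoin_simple F hr_int (le_antisymm ?_ ?_)
    · have hm : (X ^ 2 - C (⟨r ^ 2, hr⟩ : F)).Monic := monic_X_pow_sub_C _ two_ne_zero
      have h0 : aeval r (X ^ 2 - C (⟨r ^ 2, hr⟩ : F)) = 0 := by
        simp [IntermediateField.algebraMap_apply]
      have := natDegree_le_of_dvd (minpoly.dvd F r h0) hm.ne_zero
      rwa [natDegree_X_pow_sub_C] at this
    · rw [minpoly.two_le_natDegree_iff hr_int]
      rintro ⟨a, rfl⟩
      exact h a.2

-- The roots of the cubic are `z`, `z² - 2` and `(z² - 2)² - 2`, permuted cyclically by `c ↦ c² -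
-- 2`. So a root in `F` brings `z` into `F`, and otherwise the cubic is irreducible.
open Polynomial in
theorem finrank_sup_cubic (F : IntermediateField K L) {z : L}
    (hz : z ^ 3 + z ^ 2 - 2 * z - 1 = 0) {P : Prop} [Decidable P] (hP : P ↔ z ∉ F) :
    Module.finrank K ↥(F ⊔ K⟮z⟯) = Module.finrank K F * (if P then 3 else 1) := by
  split_ifs with h <;> rw [hP] at h
  swap
  · rw [sup_eq_left.2 (adjoin_simple_le_iff.2 (not_not.1 h)), mul_one]
  · have hdeg : (X ^ 3 + X ^ 2 - X - X - 1 : F[X]).natDegree = 3 := by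
      compute_degree!
    have hm : (X ^ 3 + X ^ 2 - X - X - 1 : F[X]).Monic := by
      monicity!
    have h0 : aeval z (X ^ 3 + X ^ 2 - X - X - 1 : F[X]) = 0 := by
      simp only [map_sub, map_add, map_pow, aeval_X, map_one]
      linear_combination hz
    have hirr : Irreducible (X ^ 3 + X ^ 2 - X - X - 1 : F[X]) := by
      rw [hm.irreducible_iff_roots_eq_zero_of_degree_le_three (by rw [hdeg]; norm_num) hdeg.le,
        Multiset.eq_zero_iff_forall_notMem]
      intro a ha
      rw [mem_roots hm.ne_zero, IsRoot] at ha
      have ha' : (a : L) ^ 3 + (a : L) ^ 2 - 2 * a - 1 = 0 := by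
        have := congrArg (algebraMap F L) ha
        simp only [eval_sub, eval_add, eval_pow, eval_X, eval_one, map_sub, map_add, map_pow,
          IntermediateField.algebraMap_apply, map_one, map_zero] at this
        linear_combination this
      have hprod : ((a : L) - z) * ((a - (z ^ 2 - 2)) * (a - ((z ^ 2 - 2) ^ 2 - 2))) = 0 := by
        linear_combination ha' + (-1 + a ^ 2 - a ^ 2 * z + 2 * a + a * z ^ 3 - 4 * a * z - z ^ 4
          + z ^ 3 + 3 * z ^ 2 - 2 * z) * hz
      have h2 : (2 : L) ∈ F := ofNat_mem F 2
      have hcl {c : L} (hc : c ∈ F) : c ^ 2 - 2 ∈ F := sub_mem (pow_mem hc 2) h2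
      rcases mul_eq_zero.1 hprod with e | e
      · exact h (sub_eq_zero.1 e ▸ a.2)
      rcases mul_eq_zero.1 e with e | e
      · have hz' : z = ((a : L) ^ 2 - 2) ^ 2 - 2 := by
          rw [sub_eq_zero.1 e]
          linear_combination (2 - z ^ 5 + z ^ 4 + 5 * z ^ 3 - 4 * z ^ 2 - 5 * z) * hz
        exact h (hz' ▸ hcl (hcl a.2))
      · have hz' : z = (a : L) ^ 2 - 2 := by
          rw [sub_eq_zero.1 e]
          linear_combination (2 - z ^ 5 + z ^ 4 + 5 * z ^ 3 - 4 * z ^ 2 - 5 * z) * hz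
        exact h (hz' ▸ hcl a.2)
    refine finrank_sup_adjoin_simple F ⟨_, hm, by simpa [aeval_def] using h0⟩ ?_
    rw [← minpoly.eq_of_irreducible_of_monic hirr h0 hm, hdeg]

theorem exists_eq_add_mul_of_mem_sup (F : IntermediateField K L) {r t : L} (hr : r ^ 2 ∈ F)
    (ht : t ∈ F ⊔ K⟮r⟯) : ∃ α ∈ F, ∃ β ∈ F, t = α + β * r := by
  rw [← restrictScalars_adjoin_eq_sup, mem_restrictScalars, ← mem_toSubalgebra,
    adjoin_simple_toSubalgebra_of_isAlgebraic (isIntegral_of_sq_mem F hr).isAlgebraic] at ht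
  induction ht using Algebra.adjoin_induction with
  | mem x hx => exact ⟨0, zero_mem F, 1, one_mem F, by rw [Set.mem_singleton_iff.1 hx]; ring⟩
  | algebraMap a => exact ⟨a, a.2, 0, zero_mem F, by simp [IntermediateField.algebraMap_apply]⟩
  | add x y _ _ hx hy =>
    obtain ⟨α, hα, β, hβ, rfl⟩ := hx
    obtain ⟨γ, hγ, δ, hδ, rfl⟩ := hy
    exact ⟨α + γ, add_mem hα hγ, β + δ, add_mem hβ hδ, by ring⟩
  | mul x y _ _ hx hy =>
    obtain ⟨α, hα, β, hβ, rfl⟩ := hx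
    obtain ⟨γ, hγ, δ, hδ, rfl⟩ := hy
    exact ⟨α * γ + β * δ * r ^ 2, add_mem (mul_mem hα hγ) (mul_mem (mul_mem hβ hδ) hr),
      α * δ + β * γ, add_mem (mul_mem hα hδ) (mul_mem hβ hγ), by ring⟩

/-- If `t² = p + q r` for some `t ∈ F(r)`, where `r² ∈ F` and `(p² - q² r²) r²` is a nonzero square
in `F`, then `r ∈ F`: otherwise `F(t) / F` would be cyclic of degree `4`. -/
theorem mem_of_sqrt_mem_sup [CharZero L] (F : IntermediateField K L) {r t p q w : L}
    (hr : r ^ 2 ∈ F) (ht : t ∈ F ⊔ K⟮r⟯) (hp : p ∈ F) (hq : q ∈ F) (hw : w ∈ F)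
    (e : t ^ 2 = p + q * r) (e' : (p ^ 2 - q ^ 2 * r ^ 2) * r ^ 2 = w ^ 2) (hw0 : w ≠ 0) :
    r ∈ F := by
  by_contra h
  obtain ⟨α, hα, β, hβ, rfl⟩ := exists_eq_add_mul_of_mem_sup F hr ht
  have h2 : (2 : L) ∈ F := ofNat_mem F 2
  have hlin : (α ^ 2 + β ^ 2 * r ^ 2 - p) = (q - 2 * α * β) * r := by linear_combination e
  have hq' : q - 2 * α * β = 0 := by
    by_contra h0
    refine h ?_
    rw [← mul_div_cancel_left₀ r h0, ← hlin]
    exact div_mem (sub_mem (add_mem (pow_mem hα 2) (mul_mem (pow_mem hβ 2) hr)) hp)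
      (sub_mem hq (mul_mem (mul_mem h2 hα) hβ))
  rw [hq', zero_mul] at hlin
  have hn : α ^ 2 - β ^ 2 * r ^ 2 ∈ F := sub_mem (pow_mem hα 2) (mul_mem (pow_mem hβ 2) hr)
  -- With `t = α + β r` one has `p = α² + β² r²` and `q = 2 α β`, so `p² - q² r²` is the square of
  -- `α² - β² r²`. Hence `r` is `± w` divided by an element of `F`.
  have hsq : ((α ^ 2 - β ^ 2 * r ^ 2) * r) ^ 2 = w ^ 2 := by
    rw [← e', sub_eq_zero.1 hq', ← sub_eq_zero.1 hlin]
    ring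
  have hn0 : α ^ 2 - β ^ 2 * r ^ 2 ≠ 0 := by
    intro h0
    rw [h0, zero_mul, zero_pow two_ne_zero, eq_comm, sq_eq_zero_iff] at hsq
    exact hw0 hsq
  refine h ?_
  rw [← mul_div_cancel_left₀ r hn0]
  rcases sq_eq_sq_iff_eq_or_eq_neg.1 hsq with h' | h'
  · rw [h']
    exact div_mem hw hn
  · rw [h']
    exact div_mem (neg_mem hw) hn

end Tower

/-! ### Combinatorics of the table. -/

section TableLemmas

open Cond

/-- The degree of the division field if `T` is the set of conditions that hold. -/
def weight (T : Finset Cond) : ℕ :=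
  (if A ∈ T then 2 else 1) * (if B1 ∈ T then 3 else 1) * (if B2 ∈ T then 2 else 1)
    * (if C ∈ T then 2 else 1) * (if D ∈ T then 2 else 1) * (if E ∈ T then 2 else 1)

/-- The restriction on the set of conditions that hold. -/
def Chain (T : Finset Cond) : Prop :=
  (B2 ∈ T → C ∈ T) ∧ (C ∈ T → D ∈ T) ∧ (D ∈ T → E ∈ T)

instance : DecidablePred Chain := fun T => by unfold Chain; infer_instance

/-- This covers every listed set, including those that violate `Chain`, such as `{A, B2}`. -/
theorem eq_weight_of_table {d : ℕ} {T : Finset Cond} (h : Table d T) : d = weight T := by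
  cases h with
  | deg96 => decide
  | deg48 S hS h => revert S; decide
  | deg32 => decide
  | deg24 => decide
  | deg24' p q hp hq => revert p q; decide
  | deg16 S hS h => revert S; decide
  | deg12 p hp => revert p; decide
  | deg8 S hS h => revert S; decide
  | deg6 p hp => revert p; decide
  | deg4 => decide
  | deg4' p hp => revert p; decide
  | deg3 => decide
  | deg2 p hp => revert p; decide
  | deg1 => decide

/-- A and B1 are free and the rest is a final segment of B2, C, D, E, giving `4 * 5 = 20` sets. They
are written in the shape of the constructors of `Table`. -/
theorem chain_cases : ∀ T : Finset Cond, Chain T →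
    T = {A, B1, B2, C, D, E} ∨ T = {B1, E} ∪ {A, C, D} ∨ T = {B1, E, A, D} ∨ T = {B1, E, A} ∨
    T = {B1, A} ∨ T = {B1, E} ∪ {B2, C, D} ∨ T = {B1, E, C, D} ∨ T = {B1, E, D} ∨ T = {B1, E} ∨
    T = {B1} ∨ T = {A, B2, C, D, E} ∨ T = {E} ∪ {A, C, D} ∨ T = {E} ∪ {A, D} ∨ T = {E, A} ∨
    T = {A} ∨ T = {E} ∪ {B2, C, D} ∨ T = {E} ∪ {C, D} ∨ T = {E, D} ∨ T = {E} ∨ T = ∅ := by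
  decide

theorem table_weight {T : Finset Cond} (h : Chain T) : Table (weight T) T := by
  rcases chain_cases T h with rfl | rfl | rfl | rfl | rfl | rfl | rfl | rfl | rfl | rfl | rfl |
      rfl |
    rfl | rfl | rfl | rfl | rfl | rfl | rfl | rfl
  · exact Table.deg96
  · exact Table.deg48 {A, C, D} (by decide) (by decide)
  · exact Table.deg24' A D (by decide) (by decide)
  · exact Table.deg12 A (by decide)
  · exact Table.deg6 A (by decide)
  · exact Table.deg48 {B2, C, D} (by decide) (by decide)
  · exact Table.deg24
  · exact Table.deg12 D (by decide)
  · exact Table.deg6 E (by decide)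
  · exact Table.deg3
  · exact Table.deg32
  · exact Table.deg16 {A, C, D} (by decide) (by decide)
  · exact Table.deg8 {A, D} (by decide) (by decide)
  · exact Table.deg4' A (by decide)
  · exact Table.deg2 A (by decide)
  · exact Table.deg16 {B2, C, D} (by decide) (by decide)
  · exact Table.deg8 {C, D} (by decide) (by decide)
  · exact Table.deg4' D (by decide)
  · exact Table.deg2 E (by decide)
  · exact Table.deg1

theorem weight_mem_degrees : ∀ T : Finset Cond, Chain T → weight T ∈ degrees := by
  decide

end TableLemmas

/-! ### The numbers `i`, `ζ₇`, `√θ₁`, `x₁`, `y₁` and the 7-torsion point they define. -/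

section Data

variable {K L : Type*} [Field K] [Field L] [Algebra K L]

theorem realGen_mem (F : IntermediateField K L) {i ζ : L} (hi : i ∈ F) (hζ : ζ ∈ F) :
    realGen i ζ ∈ F :=
  mul_mem hi (sub_mem hζ (pow_mem hζ 6))

/-- The hypotheses on the numbers `i`, `ζ₇`, `√θ₁`, `x₁`, `y₁`. -/
structure IsSevenData (b : K) (i ζ s x y : L) : Prop where
  b_ne : b ≠ 0
  i_sq : i ^ 2 = -1
  prim : IsPrimitiveRoot ζ 7
  s_sq : s ^ 2 = thetaOne i ζ
  x_sq : x ^ 2 = omegaOne i ζ * algebraMap K L b + 1 / 2 * algebraMap K L b * s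
  y_sq : y ^ 2 = (omegaOne i ζ + 1 / 2 * s + 1) * algebraMap K L b * x

namespace IsSevenData

variable {b : K} {i ζ s x y : L}

theorem rel (h : IsSevenData b i ζ s x y) :
    realGen i ζ ^ 6 - 7 * realGen i ζ ^ 4 + 14 * realGen i ζ ^ 2 - 7 = 0 :=
  realGen_relation h.i_sq (cyclotomic_seven_relation h.prim)

theorem omega_eq (h : IsSevenData b i ζ s x y) : omegaOne i ζ = omegaReal (realGen i ζ) :=
  omegaOne_eq h.i_sq (cyclotomic_seven_relation h.prim)

theorem beta_ne (h : IsSevenData b i ζ s x y) : algebraMap K L b ≠ 0 := by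
  simpa using h.b_ne

variable [CharZero L]

theorem theta_eq (h : IsSevenData b i ζ s x y) : thetaOne i ζ = thetaReal (realGen i ζ) :=
  thetaOne_eq h.i_sq (cyclotomic_seven_relation h.prim)

theorem u_rel (h : IsSevenData b i ζ s x y) :
    (omegaOne i ζ + 1 / 2 * s - omegaReal (realGen i ζ)) ^ 2 = thetaReal (realGen i ζ) / 4 := by
  rw [h.omega_eq, ← h.theta_eq, ← h.s_sq]
  ring

theorem psi (h : IsSevenData b i ζ s x y) : psiSeven (omegaOne i ζ + 1 / 2 * s) = 0 :=
  psiSeven_eq_zero h.rel h.u_rel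

theorem x_sq' (h : IsSevenData b i ζ s x y) : x ^ 2 = algebraMap K L b * (omegaOne i ζ + 1 / 2 *
    s) := by
  rw [h.x_sq]
  ring

theorem equation (h : IsSevenData b i ζ s x y) : y ^ 2 = x ^ 3 + algebraMap K L b * x := by
  rw [h.y_sq]
  linear_combination (-x) * h.x_sq'

theorem y_ne (h : IsSevenData b i ζ s x y) : y ≠ 0 :=
  Y_ne_zero_of_psiSeven h.beta_ne h.x_sq' h.psi h.equation

theorem x_ne (h : IsSevenData b i ζ s x y) : x ≠ 0 := fun hx => h.y_ne <| by
  have := h.equation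
  rw [hx] at this
  simpa using this

theorem nonsingular (h : IsSevenData b i ζ s x y) : (curve (algebraMap K L
    b)).toAffine.Nonsingular x y :=
  curve_nonsingular h.equation h.y_ne

theorem seven_smul (h : IsSevenData b i ζ s x y) [DecidableEq L] :
    7 • Point.some x y h.nonsingular = 0 :=
  seven_smul_of_psiSeven h.beta_ne h.x_sq' h.psi _

theorem zeta_mem (h : IsSevenData b i ζ s x y) (F : IntermediateField K L) (hi : i ∈ F)
    (hρ : realGen i ζ ∈ F) : ζ ∈ F := by
  have h2 : (2 : L) ∈ F := ofNat_mem F 2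
  rw [zeta_eq h.i_sq h.prim]
  exact div_mem (sub_mem (sub_mem (pow_mem (sub_mem (pow_mem (sub_mem h2 (pow_mem hρ 2)) 2) h2) 2)
    h2) (mul_mem hi hρ)) h2

end IsSevenData

end Data

/-! ### The tower of fields, its degree, and its identification with the division field. -/

section Degree

variable {K L : Type*} [Field K] [Field L] [Algebra K L]

theorem adjoin_pair_eq_sup (a c : L) : adjoin K {a, c} = adjoin K {a} ⊔ K⟮c⟯ := by
  rw [← adjoin_union, Set.singleton_union]

theorem adjoin_triple_eq_sup (a c d : L) : adjoin K {a, c, d} = adjoin K {a, c} ⊔ K⟮d⟯ := by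
  rw [← adjoin_union]
  congr 1
  ext
  simp only [Set.mem_insert_iff, Set.mem_singleton_iff, Set.mem_union]
  tauto

theorem mem_omega (F : IntermediateField K L) {i ζ : L} (hi : i ∈ F) (hζ : ζ ∈ F) :
    omegaOne i ζ ∈ F := by
  have hn (n : ℕ) [n.AtLeastTwo] : (ofNat(n) : L) ∈ F := ofNat_mem F n
  unfold omegaOne
  refine sub_mem (add_mem (add_mem (add_mem (add_mem (add_mem ?_ ?_) ?_) ?_) ?_) ?_) (hn 3)
  · exact mul_mem (add_mem (mul_mem (hn 6) hi) (hn 4)) (pow_mem hζ 5)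
  · exact mul_mem (sub_mem (mul_mem (hn 6) hi) (hn 2)) (pow_mem hζ 4)
  · exact mul_mem (sub_mem (mul_mem (hn 2) hi) (hn 2)) (pow_mem hζ 3)
  · exact mul_mem (add_mem (mul_mem (hn 2) hi) (hn 4)) (pow_mem hζ 2)
  · exact mul_mem (mul_mem (hn 8) hi) hζ
  · exact mul_mem (hn 4) hi

theorem half_mem (F : IntermediateField K L) : (1 / 2 : L) ∈ F :=
  div_mem (one_mem F) (ofNat_mem F 2)

theorem u_add_one_mem (F : IntermediateField K L) {i ζ s : L} (hi : i ∈ F)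
    (hζ : ζ ∈ F) (hs : s ∈ F) (b : K) :
    (omegaOne i ζ + 1 / 2 * s + 1) * algebraMap K L b ∈ F :=
  mul_mem (add_mem (add_mem (mem_omega F hi hζ) (mul_mem (half_mem F) hs)) (one_mem F))
    (F.algebraMap_mem b)

theorem baseChange_curve (b : K) : (curve b).baseChange L = curve (algebraMap K L b) := by
  simp [WeierstrassCurve.baseChange, curve, WeierstrassCurve.map]

theorem mem_holding {i ζ s x y : L} {c : Cond} :
    c ∈ holding K i ζ s x y ↔ c.Holds K i ζ s x y := by
  simp [holding]

namespace IsSevenData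

variable {b : K} {i ζ s x y : L}

theorem realGen_sq_mem (h : IsSevenData b i ζ s x y) (F : IntermediateField K L)
    (hz : ζ + ζ⁻¹ ∈ F) : realGen i ζ ^ 2 ∈ F := by
  rw [realGen_sq_eq h.i_sq h.prim]
  exact sub_mem (ofNat_mem F 4) (pow_mem hz 2)

variable [CharZero L]

theorem s_mem (h : IsSevenData b i ζ s x y) (F : IntermediateField K L) (hi : i ∈ F) (hζ : ζ ∈ F)
    (hx : x ∈ F) : s ∈ F := by
  have h2 : (2 : L) ∈ F := ofNat_mem F 2
  have hs : s = 2 * (x ^ 2 / algebraMap K L b - omegaOne i ζ) := by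
    rw [h.x_sq', mul_div_cancel_left₀ _ h.beta_ne]
    ring
  rw [hs]
  exact mul_mem h2 (sub_mem (div_mem (pow_mem hx 2) (F.algebraMap_mem b)) (mem_omega F hi hζ))

/-- Replacing `ζ` by `ρ`, whose square lies in `K(i, ζ + ζ⁻¹)`, turns this step into the adjunction
of a square root. -/
theorem adjoin_i_zeta (h : IsSevenData b i ζ s x y) :
    adjoin K {i, ζ} = adjoin K {i, ζ + ζ⁻¹} ⊔ K⟮realGen i ζ⟯ := by
  apply le_antisymm
  · have hi : i ∈ adjoin K {i, ζ + ζ⁻¹} ⊔ K⟮realGen i ζ⟯ :=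
      le_sup_left (a := adjoin K {i, ζ + ζ⁻¹}) (subset_adjoin K _ (by simp))
    refine adjoin_le_iff.2 ?_
    rintro _ (rfl | rfl)
    · exact hi
    · exact h.zeta_mem _ hi (le_sup_right (a := adjoin K {i, _}) (mem_adjoin_simple_self K _))
  · have hi : i ∈ adjoin K {i, ζ} := subset_adjoin K _ (by simp)
    have hζ : ζ ∈ adjoin K {i, ζ} := subset_adjoin K _ (by simp)
    refine sup_le (adjoin_le_iff.2 ?_) (adjoin_simple_le_iff.2 (realGen_mem _ hi hζ))
    rintro _ (rfl | rfl)
    · exact hi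
    · exact add_mem hζ (inv_mem hζ)

theorem adjoin_i_zeta_x (h : IsSevenData b i ζ s x y) :
    adjoin K {i, ζ, x} = adjoin K {i, ζ, s} ⊔ K⟮x⟯ := by
  rw [adjoin_triple_eq_sup, adjoin_triple_eq_sup, sup_assoc, sup_comm K⟮s⟯, ← sup_assoc, eq_comm,
    sup_eq_left, adjoin_simple_le_iff, ← adjoin_triple_eq_sup]
  exact h.s_mem _ (subset_adjoin K _ (by simp)) (subset_adjoin K _ (by simp))
    (subset_adjoin K _ (by simp))

theorem s_sq_mem (h : IsSevenData b i ζ s x y) (F : IntermediateField K L) (hi : i ∈ F)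
    (hζ : ζ ∈ F) : s ^ 2 ∈ F := by
  have hn (n : ℕ) [n.AtLeastTwo] : (ofNat(n) : L) ∈ F := ofNat_mem F n
  have hρ := realGen_mem F hi hζ
  rw [h.s_sq, h.theta_eq, thetaReal]
  refine sub_mem (add_mem (add_mem (sub_mem (sub_mem (hn 736) ?_) ?_) ?_) ?_) ?_
  · exact mul_mem (hn 96) hρ
  · exact mul_mem (hn 1120) (pow_mem hρ 2)
  · exact mul_mem (hn 384) (pow_mem hρ 3)
  · exact mul_mem (hn 336) (pow_mem hρ 4)
  · exact mul_mem (div_mem (hn 992) (hn 7)) (pow_mem hρ 5)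

theorem x_sq_mem (h : IsSevenData b i ζ s x y) (F : IntermediateField K L) (hi : i ∈ F)
    (hζ : ζ ∈ F) (hs : s ∈ F) : x ^ 2 ∈ F := by
  rw [h.x_sq']
  exact mul_mem (F.algebraMap_mem b) (add_mem (mem_omega F hi hζ) (mul_mem (half_mem F) hs))

/-- The cyclic quartic criterion over `K(i, ζ + ζ⁻¹)` with `r = ρ` and `t = √θ₁`; the sign in
`thetaReal_mul_thetaReal_neg` is absorbed by `i`. -/
theorem zeta_mem_of_s_mem (h : IsSevenData b i ζ s x y) (hs : s ∈ adjoin K {i, ζ}) :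
    ζ ∈ adjoin K {i, ζ + ζ⁻¹} := by
  have hi : i ∈ adjoin K {i, ζ + ζ⁻¹} := subset_adjoin K _ (by simp)
  have hρ2 := h.realGen_sq_mem (adjoin K {i, ζ + ζ⁻¹}) (subset_adjoin K _ (by simp))
  rw [h.adjoin_i_zeta] at hs
  have e := h.s_sq
  rw [h.theta_eq] at e
  have hnorm := thetaReal_mul_thetaReal_neg h.rel
  have hne := sqrt_thetaReal_mul_thetaReal_neg_ne_zero h.rel
  refine h.zeta_mem _ hi ?_
  generalize realGen i ζ = ρ at *
  generalize adjoin K {i, ζ + ζ⁻¹} = F at *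
  have hn (n : ℕ) [n.AtLeastTwo] : (ofNat(n) : L) ∈ F := ofNat_mem F n
  have hρ4 : ρ ^ 4 ∈ F := by
    rw [show ρ ^ 4 = (ρ ^ 2) ^ 2 by ring]
    exact pow_mem hρ2 2
  have hi0 : i ≠ 0 := by
    rintro rfl
    simpa using h.i_sq
  -- `p` and `q ρ` are the even and odd parts of `thetaReal ρ`.
  refine mem_of_sqrt_mem_sup F (p := 736 - 1120 * ρ ^ 2 + 336 * ρ ^ 4)
    (q := -96 + 384 * ρ ^ 2 - 992 / 7 * ρ ^ 4) (w := i * (-96 - 16 * ρ ^ 4 + 80 * ρ ^ 2))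
    hρ2 hs ?_ ?_ ?_ ?_ ?_ (mul_ne_zero hi0 hne)
  · exact add_mem (sub_mem (hn 736) (mul_mem (hn 1120) hρ2)) (mul_mem (hn 336) hρ4)
  · exact sub_mem (add_mem (neg_mem (hn 96)) (mul_mem (hn 384) hρ2))
      (mul_mem (div_mem (hn 992) (hn 7)) hρ4)
  · exact mul_mem hi (add_mem (sub_mem (neg_mem (hn 96)) (mul_mem (hn 16) hρ4))
      (mul_mem (hn 80) hρ2))
  · rw [e, thetaReal]
    ring
  · rw [mul_pow, h.i_sq, ← hnorm, thetaReal, thetaReal]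
    ring

/-- The criterion over `K(i, ζ)` with `r = √θ₁` and `t = x₁`; the square comes from
`thetaReal_mul_norm`, scaled by `b²`. -/
theorem s_mem_of_x_mem (h : IsSevenData b i ζ s x y) (hx : x ∈ adjoin K {i, ζ, s}) :
    s ∈ adjoin K {i, ζ} := by
  have hi : i ∈ adjoin K {i, ζ} := subset_adjoin K _ (by simp)
  have hζ : ζ ∈ adjoin K {i, ζ} := subset_adjoin K _ (by simp)
  rw [adjoin_triple_eq_sup] at hx
  have hnorm := thetaReal_mul_norm h.rel
  have hne := sqrt_thetaReal_mul_norm_ne_zero h.rel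
  rw [← h.theta_eq, ← h.omega_eq, ← h.s_sq] at hnorm
  have hs2 := h.s_sq_mem _ hi hζ
  have hω := mem_omega _ hi hζ
  have hρ := realGen_mem _ hi hζ
  generalize realGen i ζ = ρ at *
  generalize adjoin K {i, ζ} = F at *
  have hn (n : ℕ) [n.AtLeastTwo] : (ofNat(n) : L) ∈ F := ofNat_mem F n
  have hb := F.algebraMap_mem b
  have hi0 : i ≠ 0 := by
    rintro rfl
    simpa using h.i_sq
  refine mem_of_sqrt_mem_sup F (p := omegaOne i ζ * algebraMap K L b)
    (q := 1 / 2 * algebraMap K L b) (w := i * algebraMap K L b * _)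
    hs2 hx (mul_mem hω hb) (mul_mem (half_mem F) hb) ?_ h.x_sq ?_
    (mul_ne_zero (mul_ne_zero hi0 h.beta_ne) hne)
  · refine mul_mem (mul_mem hi hb) ?_
    refine add_mem (sub_mem (add_mem (add_mem (sub_mem (hn 108) ?_) ?_) ?_) ?_) ?_
    · exact mul_mem (div_mem (hn 76) (hn 7)) (pow_mem hρ 5)
    · exact mul_mem (hn 36) (pow_mem hρ 4)
    · exact mul_mem (hn 20) (pow_mem hρ 3)
    · exact mul_mem (hn 132) (pow_mem hρ 2)
    · exact mul_mem (hn 16) hρ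
  · rw [mul_pow (i * _), mul_pow i, h.i_sq, ← hnorm]
    ring

/-- The criterion with `r = x₁` and `t = y₁`. Since `y₁² = c x₁`, one has `p = 0`, and `-c² x₁⁴ = (i
c x₁²)²`. -/
theorem x_mem_of_y_mem (h : IsSevenData b i ζ s x y) (hy : y ∈ adjoin K {i, ζ, x}) :
    x ∈ adjoin K {i, ζ, s} := by
  have hi : i ∈ adjoin K {i, ζ, s} := subset_adjoin K _ (by simp)
  have hζ : ζ ∈ adjoin K {i, ζ, s} := subset_adjoin K _ (by simp)
  have hs : s ∈ adjoin K {i, ζ, s} := subset_adjoin K _ (by simp)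
  rw [h.adjoin_i_zeta_x] at hy
  have hx2 := h.x_sq_mem _ hi hζ hs
  have hc := u_add_one_mem _ hi hζ hs b
  have hi0 : i ≠ 0 := by
    rintro rfl
    simpa using h.i_sq
  have hc0 : (omegaOne i ζ + 1 / 2 * s + 1) * algebraMap K L b ≠ 0 :=
    mul_ne_zero (add_one_ne_zero_of_psiSeven h.psi) h.beta_ne
  refine mem_of_sqrt_mem_sup _ (p := 0) (q := (omegaOne i ζ + 1 / 2 * s + 1) * algebraMap K L b)
    (w := i * ((omegaOne i ζ + 1 / 2 * s + 1) * algebraMap K L b) * x ^ 2)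
    hx2 hy (zero_mem _) hc (mul_mem (mul_mem hi hc) hx2) (by rw [h.y_sq, zero_add]) ?_
    (mul_ne_zero (mul_ne_zero hi0 hc0) (pow_ne_zero 2 h.x_ne))
  rw [mul_pow (i * _), mul_pow i, h.i_sq]
  ring

theorem chain_holding (h : IsSevenData b i ζ s x y) : Chain (holding K i ζ s x y) := by
  simp only [Chain, mem_holding]
  exact ⟨mt h.zeta_mem_of_s_mem, mt h.s_mem_of_x_mem, mt h.x_mem_of_y_mem⟩

theorem finrank_adjoin_i_zeta (h : IsSevenData b i ζ s x y) :
    Module.finrank K ↥(adjoin K {i, ζ}) = (if .A ∈ holding K i ζ s x y then 2 else 1)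
      * (if .B1 ∈ holding K i ζ s x y then 3 else 1)
      * (if .B2 ∈ holding K i ζ s x y then 2 else 1) := by
  have mem {S : Set L} {a : L} (ha : a ∈ S) : a ∈ adjoin K S := subset_adjoin K _ ha
  have hζ : ζ ∈ adjoin K {i, ζ + ζ⁻¹} ↔ realGen i ζ ∈ adjoin K {i, ζ + ζ⁻¹} :=
    ⟨realGen_mem _ (mem (by simp)), h.zeta_mem _ (mem (by simp))⟩
  have e₁ := finrank_sup_sqrt (⊥ : IntermediateField K L) (r := i)
    (by rw [h.i_sq]; exact neg_mem (one_mem _))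
    (mem_holding (K := K) (i := i) (ζ := ζ) (s := s) (x := x) (y := y) (c := .A))
  have e₂ := finrank_sup_cubic K⟮i⟯ (real_cyclotomic_relation h.prim)
    (mem_holding (s := s) (x := x) (y := y) (c := .B1))
  have e₃ := finrank_sup_sqrt (adjoin K {i, ζ + ζ⁻¹}) (h.realGen_sq_mem _ (mem (by simp)))
    ((mem_holding (s := s) (x := x) (y := y) (c := .B2)).trans (not_congr hζ))
  rw [bot_sup_eq, IntermediateField.finrank_bot, one_mul] at e₁
  rw [← adjoin_pair_eq_sup, e₁] at e₂
  rw [h.adjoin_i_zeta, e₃, e₂]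

theorem finrank_adjoin (h : IsSevenData b i ζ s x y) :
    Module.finrank K ↥(adjoin K {i, ζ, x} ⊔ K⟮y⟯) = weight (holding K i ζ s x y) := by
  have mem {S : Set L} {a : L} (ha : a ∈ S) : a ∈ adjoin K S := subset_adjoin K _ ha
  have e₄ := finrank_sup_sqrt (adjoin K {i, ζ}) (h.s_sq_mem _ (mem (by simp)) (mem (by simp)))
    (mem_holding (s := s) (x := x) (y := y) (c := .C))
  have e₅ := finrank_sup_sqrt (adjoin K {i, ζ, s})
    (h.x_sq_mem _ (mem (by simp)) (mem (by simp)) (mem (by simp)))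
    (mem_holding (s := s) (x := x) (y := y) (c := .D))
  have hy2 : y ^ 2 ∈ adjoin K {i, ζ, x} := by
    rw [h.equation]
    have hx : x ∈ adjoin K {i, ζ, x} := mem (by simp)
    exact add_mem (pow_mem hx 3) (mul_mem (IntermediateField.algebraMap_mem _ b) hx)
  have e₆ := finrank_sup_sqrt (adjoin K {i, ζ, x}) hy2
    (mem_holding (s := s) (x := x) (y := y) (c := .E))
  rw [← adjoin_triple_eq_sup, h.finrank_adjoin_i_zeta] at e₄
  rw [← h.adjoin_i_zeta_x, e₄] at e₅
  rw [e₆, e₅, weight]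

theorem zeta_mem_of_i_mem_of_x_mem (h : IsSevenData b i ζ s x y) (M : IntermediateField K L)
    (hi : i ∈ M) (hx : x ∈ M) : ζ ∈ M := by
  have hu : omegaOne i ζ + 1 / 2 * s ∈ M := by
    rw [← mul_div_cancel_left₀ (omegaOne i ζ + 1 / 2 * s) h.beta_ne, ← h.x_sq']
    exact div_mem (pow_mem hx 2) (M.algebraMap_mem b)
  have hn (n : ℕ) [n.AtLeastTwo] : (ofNat(n) : L) ∈ M := ofNat_mem M n
  refine h.zeta_mem M hi ?_
  rw [realGen_eq_eval h.rel h.u_rel]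
  generalize omegaOne i ζ + 1 / 2 * s = u at hu
  repeat' first
    | exact hn _
    | exact hu
    | exact pow_mem hu _
    | exact pow_mem (hn 2) _
    | apply div_mem
    | apply sub_mem
    | apply add_mem
    | apply mul_mem
    | apply neg_mem

-- For `≤`, the points with coordinates in the right-hand field form a group containing `P` and
-- `iP`, hence all 7-torsion. For `≥`, the points `P` and `iP = (-x, i y)` yield `x`, `y` and `i`,
-- because `y ≠ 0`; then `ζ` follows from `u = x² / b`.
open scoped Classical in
theorem divisionField_eq (h : IsSevenData b i ζ s x y) :
    divisionField (curve b) L 7 = adjoin K {i, ζ, x} ⊔ K⟮y⟯ := by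
  have hJ := mulI_mulI (β := algebraMap K L b) h.i_sq
  have hfin := finite_seven_torsion (algebraMap K L b)
  have h7 := h.seven_smul
  rw [divisionField, baseChange_curve]
  apply le_antisymm
  · set M := adjoin K {i, ζ, x} ⊔ K⟮y⟯
    have hle : adjoin K {i, ζ, x} ≤ M := le_sup_left
    have hi : i ∈ M := hle (subset_adjoin K _ (by simp))
    have hx : x ∈ M := hle (subset_adjoin K _ (by simp))
    have hy : y ∈ M := le_sup_right (a := adjoin K {i, ζ, x}) (mem_adjoin_simple_self K y)
    have hP : Point.some x y h.nonsingular ∈ pointsOver M.toSubfield (M.algebraMap_mem b) := by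
      intro x' y' h' e
      rw [Point.some.injEq] at e
      exact ⟨e.1 ▸ hx, e.2 ▸ hy⟩
    have hJP : mulI h.i_sq (Point.some x y h.nonsingular)
        ∈ pointsOver M.toSubfield (M.algebraMap_mem b) := by
      intro x' y' h' e
      simp only [mulI, AddMonoidHom.coe_mk, ZeroHom.coe_mk, Point.some.injEq] at e
      exact ⟨e.1 ▸ neg_mem hx, e.2 ▸ mul_mem hi hy⟩
    refine adjoin_le_iff.2 ?_
    rintro z ⟨x', y', h', h7', hz⟩
    obtain ⟨m, n, e⟩ := exists_eq_smul_add_smul _ hJ hfin.1 hfin.2 (Point.some_ne_zero _) h7 h7'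
    have hmem := add_mem (nsmul_mem hP m) (nsmul_mem hJP n)
    obtain ⟨hx', hy'⟩ := hmem x' y' h' e.symm
    rcases hz with rfl | rfl
    · exact hx'
    · exact hy'
  · suffices H : ∀ M : IntermediateField K L,
        (∀ {x' y' : L} (h' : (curve (algebraMap K L b)).toAffine.Nonsingular x' y'),
          7 • Point.some x' y' h' = 0 → x' ∈ M ∧ y' ∈ M) → adjoin K {i, ζ, x} ⊔ K⟮y⟯ ≤ M from
      H _ fun {x' y'} h' h7' => ⟨subset_adjoin K _ ⟨x', y', h', h7', Or.inl rfl⟩,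
        subset_adjoin K _ ⟨x', y', h', h7', Or.inr rfl⟩⟩
    intro M mem
    obtain ⟨hx, hy⟩ := mem _ h7
    have hiy : i * y ∈ M := by
      have := congrArg (mulI h.i_sq) h7
      rw [map_nsmul, map_zero] at this
      exact (mem _ this).2
    have hi : i ∈ M := by
      rw [← mul_div_cancel_right₀ i h.y_ne]
      exact div_mem hiy hy
    refine sup_le (adjoin_le_iff.2 ?_) (adjoin_simple_le_iff.2 hy)
    rintro _ (rfl | rfl | rfl)
    · exact hi
    · exact h.zeta_mem_of_i_mem_of_x_mem M hi hx
    · exact hx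

end IsSevenData

end Degree

/-! ### Field embeddings and their action on the 7-torsion. -/

section Transport

variable {K L L' : Type*} [Field K] [Field L] [Algebra K L] [Field L'] [Algebra K L']
  {b : K} {i ζ s x y : L}

theorem map_omegaOne (σ : L →ₐ[K] L') (i ζ : L) : σ (omegaOne i ζ) = omegaOne (σ i) (σ ζ) := by
  simp [omegaOne, map_ofNat]

theorem map_thetaOne (σ : L →ₐ[K] L') (i ζ : L) : σ (thetaOne i ζ) = thetaOne (σ i) (σ ζ) := by
  simp [thetaOne, map_ofNat]

namespace IsSevenData

theorem map (h : IsSevenData b i ζ s x y) (σ : L →ₐ[K] L') :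
    IsSevenData b (σ i) (σ ζ) (σ s) (σ x) (σ y) where
  b_ne := h.b_ne
  i_sq := by rw [← map_pow, h.i_sq, map_neg, map_one]
  prim := h.prim.map_of_injective σ.injective
  s_sq := by rw [← map_pow, h.s_sq, map_thetaOne]
  x_sq := by
    rw [← map_pow, h.x_sq, ← map_omegaOne, ← σ.commutes, ← map_ofNat σ 2]
    simp only [map_add, map_mul, map_div₀, map_one]
  y_sq := by
    rw [← map_pow, h.y_sq, ← map_omegaOne, ← σ.commutes, ← map_ofNat σ 2]
    simp only [map_add, map_mul, map_div₀, map_one]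

theorem of_map {σ : L →ₐ[K] L'} (h : IsSevenData b (σ i) (σ ζ) (σ s) (σ x) (σ y)) :
    IsSevenData b i ζ s x y where
  b_ne := h.b_ne
  i_sq := by
    refine σ.injective (?_ : σ _ = σ _)
    rw [map_pow, h.i_sq, map_neg, map_one]
  prim := h.prim.of_map_of_injective σ.injective
  s_sq := by
    refine σ.injective (?_ : σ _ = σ _)
    rw [map_pow, h.s_sq, map_thetaOne]
  x_sq := by
    refine σ.injective (?_ : σ _ = σ _)
    rw [map_pow, h.x_sq, ← map_omegaOne, ← σ.commutes, ← map_ofNat σ 2]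
    simp only [map_add, map_mul, map_div₀, map_one]
  y_sq := by
    refine σ.injective (?_ : σ _ = σ _)
    rw [map_pow, h.y_sq, ← map_omegaOne, ← σ.commutes, ← map_ofNat σ 2]
    simp only [map_add, map_mul, map_div₀, map_one]

theorem map_divisionField [CharZero L] [CharZero L'] (h : IsSevenData b i ζ s x y)
    (σ : L →ₐ[K] L') : (divisionField (curve b) L 7).map σ = divisionField (curve b) L' 7 := by
  rw [h.divisionField_eq, (h.map σ).divisionField_eq, IntermediateField.map_sup, adjoin_map,
    adjoin_map]
  simp [Set.image_insert_eq]

end IsSevenData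

theorem exists_isSevenData (L : Type*) [Field L] [Algebra K L] [IsAlgClosed L] [CharZero L]
    (hb : b ≠ 0) : ∃ i ζ s x y : L, IsSevenData b i ζ s x y := by
  obtain ⟨i, hi⟩ := IsAlgClosed.exists_pow_nat_eq (-1 : L) two_pos
  obtain ⟨ζ, hζ⟩ := HasEnoughRootsOfUnity.exists_primitiveRoot L 7
  obtain ⟨s, hs⟩ := IsAlgClosed.exists_pow_nat_eq (thetaOne i ζ) two_pos
  obtain ⟨x, hx⟩ := IsAlgClosed.exists_pow_nat_eq
    (omegaOne i ζ * algebraMap K L b + 1 / 2 * algebraMap K L b * s) two_pos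
  obtain ⟨y, hy⟩ := IsAlgClosed.exists_pow_nat_eq
    ((omegaOne i ζ + 1 / 2 * s + 1) * algebraMap K L b * x) two_pos
  exact ⟨i, ζ, s, x, y, hb, hi, hζ, hs, hx, hy⟩

section Commute

variable [DecidableEq L]

/-- This and the next two lemmas are stated for a curve merely equal to `curve β`, so that they
apply to the base change on which `Point.map` acts. -/
theorem exists_mulI {β : L} {W : WeierstrassCurve L} (hW : W = curve β) {i : L} (hi : i ^ 2 = -1) :
    ∃ J : W.toAffine.Point →+ W.toAffine.Point, (∀ Q, J (J Q) = -Q) ∧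
      ∀ (x y : L) (h : W.toAffine.Nonsingular x y), ∃ h', J (.some x y h) = .some (-x) (i * y) h'
          := by
  subst hW
  exact ⟨mulI hi, mulI_mulI hi, fun x y h => ⟨_, rfl⟩⟩

theorem finite_seven_torsion_of_eq [CharZero L] {β : L} {W : WeierstrassCurve L}
    (hW : W = curve β) :
    {P : W.toAffine.Point | 7 • P = 0}.Finite ∧
      {P : W.toAffine.Point | 7 • P = 0}.ncard ≤ 49 := by
  subst hW
  exact finite_seven_torsion β

theorem exists_seven_torsion_point {β : L} {W : WeierstrassCurve L} (hW : W = curve β) {x y : L}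
    (h : (curve β).toAffine.Nonsingular x y) (h7 : 7 • Point.some x y h = 0) :
    ∃ h' : W.toAffine.Nonsingular x y, 7 • Point.some x y h' = 0 := by
  subst hW
  exact ⟨h, h7⟩

end Commute

-- Embeddings fixing `i` commute with multiplication by `i`. Each sends `P` to some `m P + n iP`, so
-- it acts on the 7-torsion as an element of the commutative ring `ℤ[i]`.
open scoped Classical in
theorem IsSevenData.algHom_comm [CharZero L] (h : IsSevenData b i ζ s x y) {σ τ : L →ₐ[K] L}
    (hσ : σ i = i) (hτ : τ i = i) : σ (τ x) = τ (σ x) ∧ σ (τ y) = τ (σ y) := by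
  have hW := baseChange_curve (L := L) b
  obtain ⟨J, hJ, hJ'⟩ := exists_mulI hW h.i_sq
  obtain ⟨hfin, hcard⟩ := finite_seven_torsion_of_eq hW
  obtain ⟨hP, h7⟩ := exists_seven_torsion_point hW h.nonsingular h.seven_smul
  have hcomm (f : L →ₐ[K] L) (hf : f i = i) (Q : ((curve b).baseChange L).toAffine.Point) :
      Point.map f (J Q) = J (Point.map f Q) := by
    rcases Q with _ | ⟨x', y', hQ⟩
    · have h0 : J .zero = 0 := map_zero J
      rw [h0, Point.map_zero, ← Point.zero_def, Point.map_zero, map_zero]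
    · obtain ⟨h₁, e₁⟩ := hJ' x' y' hQ
      obtain ⟨h₂, e₂⟩ := hJ' _ _ ((WeierstrassCurve.Affine.baseChange_nonsingular (curve b)
          f.injective ..).mpr hQ)
      rw [e₁, Point.map_some, Point.map_some, e₂, Point.some.injEq]
      simp [hf]
  have htor (f : L →ₐ[K] L) : 7 • Point.map f (Point.some x y hP) = 0 := by
    rw [← map_nsmul, h7, map_zero]
  have hgen {Q : ((curve b).baseChange L).toAffine.Point} (hQ : 7 • Q = 0) :=
    exists_eq_smul_add_smul J hJ hfin hcard (Point.some_ne_zero hP) h7 hQ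
  obtain ⟨m, n, e⟩ := hgen (htor σ)
  obtain ⟨m', n', e'⟩ := hgen (htor τ)
  have key : Point.map σ (Point.map τ (Point.some x y hP))
      = Point.map τ (Point.map σ (Point.some x y hP)) := by
    rw [e, e']
    simp only [map_add, map_nsmul, hcomm σ hσ, hcomm τ hτ, e, e', hJ]
    module
  simpa only [Point.map_some, Point.some.injEq] using key

end Transport

/-! ### Realizing every degree: subgroups of a group of order 96 and their fixed fields. -/

theorem exists_subgroup_card_mul {G : Type*} [Group G] [Finite G] {H : Subgroup G}
    (hH : ∀ a ∈ H, ∀ c ∈ H, a * c = c * a) {A B : Subgroup H}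
    (hAB : (Nat.card A).Coprime (Nat.card B)) :
    ∃ S : Subgroup G, Nat.card S = Nat.card A * Nat.card B := by
  have hc (a : A) (c : B) : Commute (H.subtype.comp A.subtype a) (H.subtype.comp B.subtype c) :=
    hH _ (a : H).2 _ (c : H).2
  have hinj : Function.Injective (MonoidHom.noncommCoprod _ _ hc) := by
    rw [MonoidHom.noncommCoprod_injective]
    have hA : Function.Injective (H.subtype.comp A.subtype) :=
      H.subtype_injective.comp A.subtype_injective
    have hB : Function.Injective (H.subtype.comp B.subtype) :=
      H.subtype_injective.comp B.subtype_injective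
    refine ⟨hA, hB, ?_⟩
    apply Subgroup.disjoint_of_coprime_natCard
    rwa [← Nat.card_congr (MonoidHom.ofInjective hA).toEquiv,
      ← Nat.card_congr (MonoidHom.ofInjective hB).toEquiv]
  refine ⟨(MonoidHom.noncommCoprod _ _ hc).range, ?_⟩
  rw [← Nat.card_congr (MonoidHom.ofInjective hinj).toEquiv, Nat.card_prod]

/-- Powers of 2 up to 32 come from Sylow's theorem in `G`. The orders `3 * 2 ^ k` with `k ≤ 4` come
from multiplying subgroups of coprime order inside the abelian group `H`. -/
theorem exists_subgroup_card_of_mem_degrees {G : Type*} [Group G] [Finite G]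
    (hG : Nat.card G = 96) {H : Subgroup G} (hH : ∀ a ∈ H, ∀ c ∈ H, a * c = c * a)
    (hHc : Nat.card H = 48) {d : ℕ} (hd : d ∈ degrees) : ∃ S : Subgroup G, Nat.card S = d := by
  have : Fact (Nat.Prime 2) := ⟨Nat.prime_two⟩
  have : Fact (Nat.Prime 3) := ⟨Nat.prime_three⟩
  have h2 {k : ℕ} (hk : k ≤ 5) : ∃ S : Subgroup G, Nat.card S = 2 ^ k :=
    Sylow.exists_subgroup_card_pow_prime 2 (by
      rw [hG]; exact (pow_dvd_pow 2 hk).trans (by norm_num))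
  have h3 {k : ℕ} (hk : k ≤ 4) : ∃ S : Subgroup G, Nat.card S = 3 ^ 1 * 2 ^ k := by
    obtain ⟨A, hA⟩ := Sylow.exists_subgroup_card_pow_prime (G := H) 3 (n := 1) (by
      rw [hHc]; norm_num)
    obtain ⟨B, hB⟩ := Sylow.exists_subgroup_card_pow_prime (G := H) 2 (n := k) (by
      rw [hHc]; exact (pow_dvd_pow 2 hk).trans (by norm_num))
    rw [← hA, ← hB]
    exact exists_subgroup_card_mul hH (by
      rw [hA, hB]; exact Nat.Coprime.pow _ _ (by norm_num))
  simp only [degrees, Finset.mem_insert, Finset.mem_singleton] at hd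
  rcases hd with rfl | rfl | rfl | rfl | rfl | rfl | rfl | rfl | rfl | rfl | rfl | rfl
  · exact ⟨⊤, by rw [Subgroup.card_top, hG]⟩
  · exact h3 (k := 4) (by norm_num)
  · exact h2 (k := 5) (by norm_num)
  · exact h3 (k := 3) (by norm_num)
  · exact h2 (k := 4) (by norm_num)
  · exact h3 (k := 2) (by norm_num)
  · exact h2 (k := 3) (by norm_num)
  · exact h3 (k := 1) (by norm_num)
  · exact h2 (k := 2) (by norm_num)
  · exact h3 (k := 0) (by norm_num)
  · exact h2 (k := 1) (by norm_num)
  · exact h2 (k := 0) (by norm_num)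

namespace IsSevenData

section Rational

variable {L : Type*} [Field L] [CharZero L] [Algebra ℚ L] {b : ℚ} {i ζ s x y : L}

theorem isPrimitiveRoot_i_mul_zeta (h : IsSevenData b i ζ s x y) : IsPrimitiveRoot (i * ζ) 28 := by
  have hi : IsPrimitiveRoot i 4 := by
    refine IsPrimitiveRoot.mk_of_lt _ (by norm_num) (by linear_combination (i ^ 2 - 1) * h.i_sq) ?_
    intro l hl hl' e
    interval_cases l
    · have := h.i_sq
      rw [pow_one] at e
      norm_num [e] at this
    · have := h.i_sq
      norm_num [e] at this
    · have h3 : i = -1 := by linear_combination i * h.i_sq - e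
      have := h.i_sq
      norm_num [h3] at this
  rw [IsPrimitiveRoot.iff_orderOf, (Commute.all i ζ).orderOf_mul_eq_mul_orderOf_of_coprime,
    ← hi.eq_orderOf, ← h.prim.eq_orderOf]
  rw [← hi.eq_orderOf, ← h.prim.eq_orderOf]
  norm_num

/-- `i ζ` is a primitive 28th root of unity, so `φ(28) = 12` divides `[ℚ(i, ζ) : ℚ]`, a product of
factors at most 2, 3, 2. Hence A, B1, B2 hold, and the chain supplies C, D, E. -/
theorem finrank_rat (h : IsSevenData b i ζ s x y) :
    Module.finrank ℚ (divisionField (curve b) L 7) = 96 ∧ Module.finrank ℚ ℚ⟮i⟯ = 2 := by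
  have hprim := h.isPrimitiveRoot_i_mul_zeta
  have h12 : Module.finrank ℚ ℚ⟮i * ζ⟯ = 12 := by
    rw [adjoin.finrank (hprim.isIntegral (by norm_num)).tower_top,
      ← hprim.minpoly_eq_cyclotomic_of_irreducible
        (Polynomial.cyclotomic.irreducible_rat (by norm_num)), Polynomial.natDegree_cyclotomic]
    decide
  have hle : ℚ⟮i * ζ⟯ ≤ adjoin ℚ {i, ζ} := adjoin_simple_le_iff.2 <|
    mul_mem (subset_adjoin ℚ _ (by simp)) (subset_adjoin ℚ _ (by simp))
  have hdvd := finrank_dvd_of_le_right hle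
  rw [h12, h.finrank_adjoin_i_zeta] at hdvd
  have hch := h.chain_holding
  have hA := finrank_sup_sqrt (⊥ : IntermediateField ℚ L) (r := i)
    (by rw [h.i_sq]; exact neg_mem (one_mem _))
    (mem_holding (K := ℚ) (i := i) (ζ := ζ) (s := s) (x := x) (y := y) (c := .A))
  rw [bot_sup_eq, IntermediateField.finrank_bot, one_mul] at hA
  rw [h.divisionField_eq, h.finrank_adjoin, hA]
  clear hA
  generalize holding ℚ i ζ s x y = T at *
  revert T
  decide

end Rational

end IsSevenData

namespace IsSevenData

variable {K L : Type*} [Field K] [Field L] [Algebra K L] [CharZero L] {b : K} {i ζ s x y : L}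

theorem divisionField_le (h : IsSevenData b i ζ s x y) {M : IntermediateField K L} (hi : i ∈ M)
    (hx : x ∈ M) (hy : y ∈ M) : divisionField (curve b) L 7 ≤ M := by
  rw [h.divisionField_eq]
  refine sup_le (adjoin_le_iff.2 ?_) (adjoin_simple_le_iff.2 hy)
  rintro _ (rfl | rfl | rfl)
  · exact hi
  · exact h.zeta_mem_of_i_mem_of_x_mem M hi hx
  · exact hx

theorem algHom_ext (h : IsSevenData b i ζ s x y) (htop : divisionField (curve b) L 7 = ⊤)
    {f g : L →ₐ[K] L} (hi : f i = g i) (hx : f x = g x) (hy : f y = g y) : f = g := by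
  let M : IntermediateField K L := (RingHom.eqLocusField (f : L →+* L) g).toIntermediateField
    fun a => by simp [RingHom.mem_eqLocusField]
  have hM : divisionField (curve b) L 7 ≤ M := h.divisionField_le hi hx hy
  ext z
  rw [htop] at hM
  exact hM (mem_top (x := z))

theorem mem_divisionField (h : IsSevenData b i ζ s x y) :
    i ∈ divisionField (curve b) L 7 ∧ ζ ∈ divisionField (curve b) L 7 ∧
      s ∈ divisionField (curve b) L 7 ∧ x ∈ divisionField (curve b) L 7 ∧
        y ∈ divisionField (curve b) L 7 := by
  rw [h.divisionField_eq]
  set M := adjoin K {i, ζ, x} ⊔ K⟮y⟯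
  have hle : adjoin K {i, ζ, x} ≤ M := le_sup_left
  have hi : i ∈ M := hle (subset_adjoin K _ (by simp))
  have hζ : ζ ∈ M := hle (subset_adjoin K _ (by simp))
  have hx : x ∈ M := hle (subset_adjoin K _ (by simp))
  exact ⟨hi, hζ, h.s_mem M hi hζ hx, hx,
    le_sup_right (a := adjoin K {i, ζ, x}) (mem_adjoin_simple_self K y)⟩

theorem aut_comm (h : IsSevenData b i ζ s x y) (htop : divisionField (curve b) L 7 = ⊤)
    {σ τ : L ≃ₐ[K] L} (hσ : σ i = i) (hτ : τ i = i) : σ * τ = τ * σ := by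
  obtain ⟨hx, hy⟩ := h.algHom_comm (σ := (σ : L →ₐ[K] L)) (τ := (τ : L →ₐ[K] L)) hσ hτ
  have := h.algHom_ext htop (f := (σ * τ : L ≃ₐ[K] L)) (g := (τ * σ : L ≃ₐ[K] L))
    (by simp [hσ, hτ]) hx hy
  ext z
  exact DFunLike.congr_fun this z

/-- The degree may be computed in any field that is itself the division field, since embeddings
carry division fields to division fields. -/
theorem finrank_divisionField_algebraicClosure (h : IsSevenData b i ζ s x y)
    [FiniteDimensional K L] (htop : divisionField (curve b) L 7 = ⊤) :
    Module.finrank K (divisionField (curve b) (AlgebraicClosure K) 7) = Module.finrank K L := by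
  have : CharZero K := (algebraMap K L).charZero_iff (algebraMap K L).injective |>.2 inferInstance
  have : CharZero (AlgebraicClosure K) := charZero_of_injective_algebraMap
    (algebraMap K (AlgebraicClosure K)).injective
  let σ : L →ₐ[K] AlgebraicClosure K := IsAlgClosed.lift
  rw [← h.map_divisionField σ, htop]
  rw [← (equivMap ⊤ σ).toLinearEquiv.finrank_eq, finrank_top']

theorem extendScalars (h : IsSevenData (1 : K) i ζ s x y) (F : IntermediateField K L) :
    IsSevenData (1 : F) i ζ s x y := by
  obtain ⟨_, hi, hζ, hs, hx, hy⟩ := h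
  rw [map_one] at hx hy
  exact ⟨one_ne_zero, hi, hζ, hs, by rwa [map_one], by rwa [map_one]⟩

theorem divisionField_extendScalars (h : IsSevenData (1 : K) i ζ s x y)
    (htop : divisionField (curve (1 : K)) L 7 = ⊤) (F : IntermediateField K L) :
    divisionField (curve (1 : F)) L 7 = ⊤ := by
  obtain ⟨hi, -, -, hx, hy⟩ := (h.extendScalars F).mem_divisionField
  have := h.divisionField_le (M := (divisionField (curve (1 : F)) L 7).restrictScalars K) hi hx hy
  rw [htop, top_le_iff] at this
  exact restrictScalars_eq_top_iff.1 this

end IsSevenData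

universe u

theorem exists_finite_extension_finrank_eq {k : Type*} {Ω : Type u} [Field k] [Field Ω] [Algebra
    k Ω]
    [CharZero k] [IsAlgClosure k Ω] [CharZero Ω] {i ζ s x y : Ω}
    (h : IsSevenData (1 : k) i ζ s x y)
    (h96 : Module.finrank k (divisionField (curve (1 : k)) Ω 7) = 96)
    (h2 : Module.finrank k k⟮i⟯ = 2) {d : ℕ} (hd : d ∈ degrees) :
    ∃ (F : Type u) (_ : Field F) (_ : Algebra k F), FiniteDimensional k F ∧
      Module.finrank F (divisionField (curve (1 : F)) (AlgebraicClosure F) 7) = d := by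
  obtain ⟨hi, hζ, hs, hx, hy⟩ := h.mem_divisionField
  have hmap (σ : Ω →ₐ[k] Ω) := (h.map_divisionField σ).le
  have := IsAlgClosure.normal k Ω
  -- The division field is stable under all embeddings, hence normal; with characteristic zero this
  -- makes it Galois.
  have hnorm := normal_iff_forall_map_le.2 hmap
  have h' : IsSevenData (L := divisionField (curve (1 : k)) Ω 7) (1 : k)
      ⟨i, hi⟩ ⟨ζ, hζ⟩ ⟨s, hs⟩ ⟨x, hx⟩ ⟨y, hy⟩ :=
    IsSevenData.of_map (σ := (divisionField (curve (1 : k)) Ω 7).val) h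
  have htop := h'.map_divisionField (divisionField (curve (1 : k)) Ω 7).val
  clear hmap h
  generalize divisionField (curve (1 : k)) Ω 7 = D at *
  replace htop : divisionField (curve (1 : k)) D 7 = ⊤ := by
    apply map_injective D.val
    rw [htop, ← AlgHom.fieldRange_eq_map, fieldRange_val]
  have : FiniteDimensional k D := Module.finite_of_finrank_pos (by rw [h96]; norm_num)
  have : IsGalois k D := ⟨⟩
  have hcardG : Nat.card (D ≃ₐ[k] D) = 96 := by rw [IsGalois.card_aut_eq_finrank, h96]
  have h2' : Module.finrank k k⟮(⟨i, hi⟩ : D)⟯ = 2 := by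
    rw [← h2, (equivMap k⟮(⟨i, hi⟩ : D)⟯ D.val).toLinearEquiv.finrank_eq, adjoin_map,
      Set.image_singleton, val_mk]
  have hcardH : Nat.card (fixingSubgroup k⟮(⟨i, hi⟩ : D)⟯) = 48 := by
    have := Module.finrank_mul_finrank k k⟮(⟨i, hi⟩ : D)⟯ D
    rw [h96, h2'] at this
    rw [IsGalois.card_fixingSubgroup_eq_finrank]
    omega
  have hfix {σ : D ≃ₐ[k] D} (hσ : σ ∈ fixingSubgroup k⟮(⟨i, hi⟩ : D)⟯) :
      σ ⟨i, hi⟩ = ⟨i, hi⟩ :=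
    (mem_fixingSubgroup_iff _ _).1 hσ _ (mem_adjoin_simple_self k _)
  obtain ⟨S, hS⟩ := exists_subgroup_card_of_mem_degrees hcardG
    (fun a ha c hc => h'.aut_comm htop (hfix ha) (hfix hc)) hcardH hd
  -- Over the fixed field of `S` the division field is still all of `D`, so its degree is the order
  -- of `S`.
  refine ⟨fixedField S, inferInstance, inferInstance, inferInstance, ?_⟩
  rw [(h'.extendScalars (fixedField S)).finrank_divisionField_algebraicClosure
    (h'.divisionField_extendScalars htop _), finrank_fixedField_eq_card, hS]

theorem exists_numberField_finrank_eq {d : ℕ} (hd : d ∈ degrees) :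
    ∃ (K : Type) (_ : Field K) (_ : NumberField K) (b : K), b ≠ 0 ∧
      Module.finrank K (divisionField (curve b) (AlgebraicClosure K) 7) = d := by
  obtain ⟨Ω, _, _, _⟩ : ∃ (Ω : Type) (_ : Field Ω) (_ : Algebra ℚ Ω), IsAlgClosure ℚ Ω :=
    ⟨AlgebraicClosure ℚ, _, _, AlgebraicClosure.instIsAlgClosure ℚ⟩
  have : IsAlgClosed Ω := IsAlgClosure.isAlgClosed ℚ
  have : CharZero Ω := charZero_of_injective_algebraMap (algebraMap ℚ Ω).injective
  obtain ⟨i, ζ, s, x, y, h⟩ := exists_isSevenData Ω (one_ne_zero (α := ℚ))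
  obtain ⟨F, _, hA, hF, hd⟩ :=
    exists_finite_extension_finrank_eq h h.finrank_rat.1 h.finrank_rat.2 hd
  have : CharZero F := charZero_of_injective_algebraMap (algebraMap ℚ F).injective
  -- `NumberField` refers to the canonical `ℚ`-algebra structure; any other one coincides with it.
  obtain rfl := Subsingleton.elim hA DivisionRing.toRatAlgebra
  exact ⟨F, inferInstance, { to_finiteDimensional := hF }, 1, one_ne_zero, hd⟩

end DivisionFieldSeven

open DivisionFieldSeven in
theorem theorem2 :
    (∀ (K : Type*) [Field K] [NumberField K] (Kbar : Type*) [Field Kbar] [Algebra K Kbar]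
      [IsAlgClosure K Kbar] (b : K), b ≠ 0 →
      ∀ i ζ s x₁ y₁ : Kbar, i ^ 2 = -1 → IsPrimitiveRoot ζ 7 →
        s ^ 2 = thetaOne i ζ →
        x₁ ^ 2 = omegaOne i ζ * algebraMap K Kbar b + 1 / 2 * algebraMap K Kbar b * s →
        y₁ ^ 2 = (omegaOne i ζ + 1 / 2 * s + 1) * algebraMap K Kbar b * x₁ →
        Module.finrank K (divisionField (curve b) Kbar 7) ∈ degrees ∧
        ∀ d : ℕ, Module.finrank K (divisionField (curve b) Kbar 7) = d ↔
          Table d (holding K i ζ s x₁ y₁)) ∧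
    (∀ d ∈ degrees, ∃ (K : Type) (_ : Field K) (_ : NumberField K) (b : K), b ≠ 0 ∧
      Module.finrank K (divisionField (curve b) (AlgebraicClosure K) 7) = d) := by
  refine ⟨?_, fun d hd => exists_numberField_finrank_eq hd⟩
  intro K _ _ Kbar _ _ _ b hb i ζ s x₁ y₁ hi hζ hs hx hy
  have : CharZero Kbar := charZero_of_injective_algebraMap (algebraMap K Kbar).injective
  have h : IsSevenData b i ζ s x₁ y₁ := ⟨hb, hi, hζ, hs, hx, hy⟩
  rw [h.divisionField_eq, h.finrank_adjoin]
  refine ⟨weight_mem_degrees _ h.chain_holding, fun d =>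
    ⟨?_, fun ht => (eq_weight_of_table ht).symm⟩⟩
  rintro rfl
  exact table_weight h.chain_holding
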